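/- By a graph $G=(V,E)$ we mean a multigraph without self-loops: every edge has two distinct endpoints, and several edges may have the same endpoints. Let $G$ be infinite, connected and of bounded degree, and suppose that $V$ with the graph distance $d$ is quasi-isometric to (the vertex set of) a tree with its graph distance. Definitions. Paths are identified with their sets of edges; a path is self-avoiding if it has no repeated vertex. For $\epsilon>0$, a path $\pi'$ is an $\epsilon$-detour for a path $\pi$ if $\pi'$ and $\pi$ have the same endpoints, $\pi'\neq\pi$ as edge sets, and $|\pi'\setminus\pi|\le(1+\epsilon)|\pi\setminus\pi'|$. $G$ admits detours if for every $\epsilon>0$ there is $C$ such that every self-avoiding path in $G$ of length $C$ has a self-avoiding $\epsilon$-detour. For a probability measure $\nu$ on $[0,\infty)$, let $(w(e))_{e\in E}$ be independent with distribution $\nu$ and let $T(x,y)$ be the infimum, over paths $\gamma$ from $x$ to $y$, of the sum of $w$ over the edges of $\gamma$; $\tilde T$ is the same for $\tilde\nu$. Write $\mathbb{E}\tilde T\ll\mathbb{E}T$ if $$\liminf_{d(x,y)\to\infty}\frac{\mathbb{E}T(x,y)-\mathbb{E}\tilde T(x,y)}{d(x,y)}>0.$$ $\tilde\nu$ is more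 variable than $\nu$ if $\int f\,d\tilde\nu\le\int f\,d\nu$ for every concave nondecreasing $f:\mathbb{R}\to\mathbb{R}$ for which both integrals converge absolutely, and strictly more variable if moreover $\tilde\nu\neq\nu$. Let $G_p$ be Bernoulli bond percolation on $G$ with parameter $p\in[0,1]$, and let $B(o,R)=\{y\in V:d(o,y)\le R\}$. Let $\underline{p_c}$ be the supremum of the $p\in[0,1]$ with $$\limsup_{R\to\infty}\sup_{o\in V}\frac1R\log\mathbb{P}\big(G_p\text{ contains a path from }o\text{ to }B(o,R)^c\big)<0,$$ and let $\vec{\underline{p_c}}$ be defined in the same way with only those paths that are edge-geodesics of $G$ (shortest paths between their endpoints). With $a=\inf\operatorname{supp}\nu$, the measure $\nu$ is exponential-subcritical if either $a=0$ and $\nu(\{0\})<\underline{p_c}$, or $a>0$ and $\nu(\{a\})<\vec{\underline{p_c}}$. $G$ has the van den Berg-Kesten (vdBK) property if $\mathbb{E}\tilde T\ll\mathbb{E}T$ for all probability measures $\nu,\tilde\nu$ on $[0,\infty)$ with finite mean such that $\nu$ is exponential-subcritical and $\tilde\nu$ is strictly more variable than $\nu$. Theorem. $G$ has the vdBK property if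 and only if $G$ admits detours. Moreover, if $G$ admits detours, then $\mathbb{E}\tilde T\ll\mathbb{E}T$ for all probability measures $\nu,\tilde\nu$ on $[0,\infty)$ with finite mean such that $\tilde\nu$ is strictly more variable than $\nu$ (whether or not $\nu$ is exponential-subcritical). -/

import Mathlib

open MeasureTheory Filter
open scoped Graph NNReal ENNReal

namespace FPP

universe u v

/-! ### Paths in a multigraph -/

/-- A path from `x` to `y`: an alternating sequence of vertices and edges, each edge joining the
vertices next to it. Vertices and edges may be repeated. -/
inductive Path {α : Type u} {β : Type v} (G : Graph α β) : V(G) → V(G) → Type (max u v)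
  | nil (x : V(G)) : Path G x x
  | cons {x y z : V(G)} (e : E(G)) (h : G.IsLink e x y) (p : Path G y z) : Path G x z

namespace Path

variable {α : Type u} {β : Type v} {G : Graph α β}

/-- The sequence of edges of a path. -/
def edges : {x y : V(G)} → Path G x y → List E(G)
  | _, _, nil _ => []
  | _, _, cons e _ p => e :: p.edges

/-- The sequence of vertices of a path, both endpoints included. -/
def vertices : {x y : V(G)} → Path G x y → List V(G)
  | _, _, nil x => [x]
  | x, _, cons _ _ p => x :: p.vertices

/-- The number of steps of a path. -/
def length {x y : V(G)} (p : Path G x y) : ℕ := p.edges.length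

/-- The set of edges appearing in a path. -/
def edgeSet {x y : V(G)} (p : Path G x y) : Set E(G) := {e | e ∈ p.edges}

/-- A path is self-avoiding if it has no repeated vertex. -/
def IsSelfAvoiding {x y : V(G)} (p : Path G x y) : Prop := p.vertices.Nodup

/-- A path is an edge-geodesic if no path with the same endpoints is shorter. -/
def IsGeodesic {x y : V(G)} (p : Path G x y) : Prop := ∀ q : Path G x y, p.length ≤ q.length

/-- `q` is an `ε`-detour for `p`: it has the same endpoints, is different from `p` as a set of
edges, and `|q \ p| ≤ (1 + ε) |p \ q|`. -/
def IsDetour (ε : ℝ) {x y : V(G)} (q p : Path G x y) : Prop :=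
  q.edgeSet ≠ p.edgeSet ∧
    ((q.edgeSet \ p.edgeSet).ncard : ℝ) ≤ (1 + ε) * ((p.edgeSet \ q.edgeSet).ncard : ℝ)

/-- The passage time of a path for the edge weights `w`; the sum is over the sequence of edges. -/
def passageTime (w : E(G) → ℝ≥0) {x y : V(G)} (p : Path G x y) : ℝ≥0 := (p.edges.map w).sum

end Path

section Graphs

variable {α : Type u} {β : Type v} (G : Graph α β)

/-- Every two vertices are joined by a path. -/
def IsConnected : Prop := ∀ x y : V(G), Nonempty (Path G x y)

/-- The number of edges at a vertex is bounded uniformly over all vertices. -/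
def HasBoundedDegree : Prop := ∃ D : ℕ, ∀ x : V(G), (G.incidenceSet x).encard ≤ D

/-- The graph distance. -/
noncomputable def gdist (x y : V(G)) : ℕ := ⨅ p : Path G x y, p.length

/-- For every `ε > 0` there is a length `C` such that every self-avoiding path of length `C` has a
self-avoiding `ε`-detour. -/
def AdmitsDetours : Prop :=
  ∀ ε : ℝ, 0 < ε → ∃ C : ℕ, ∀ (x y : V(G)) (p : Path G x y), p.IsSelfAvoiding → p.length = C →
    ∃ q : Path G x y, q.IsSelfAvoiding ∧ q.IsDetour ε p

end Graphs

/-- `f` is a quasi-isometry for the distance functions `dX` and `dY`. -/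
def IsQuasiIsometry {X Y : Type*} (dX : X → X → ℝ) (dY : Y → Y → ℝ) (f : X → Y) : Prop :=
  ∃ K C : ℝ, 1 ≤ K ∧ 0 ≤ C ∧
    (∀ x x' : X, K⁻¹ * dX x x' - C ≤ dY (f x) (f x') ∧ dY (f x) (f x') ≤ K * dX x x' + C) ∧
    ∀ y : Y, ∃ x : X, dY (f x) y ≤ C

/-- The vertex set of `G` is quasi-isometric to that of the simple graph `S`, both with the graph
distance. -/
def QuasiIsometricTo {α : Type u} {β : Type v} (G : Graph α β) {W : Type*}
    (S : SimpleGraph W) : Prop :=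
  ∃ f : V(G) → W, IsQuasiIsometry (fun x y => (gdist G x y : ℝ)) (fun s t => (S.dist s t : ℝ)) f

/-! ### Weight distributions: measures on `[0, ∞)` -/

/-- The measure has finite mean. -/
def HasFiniteMean (ν : Measure ℝ≥0) : Prop := Integrable (fun t : ℝ≥0 => (t : ℝ)) ν

/-- `ν'` is more variable than `ν`. -/
def MoreVariable (ν' ν : Measure ℝ≥0) : Prop :=
  ∀ f : ℝ → ℝ, ConcaveOn ℝ Set.univ f → Monotone f →
    Integrable (fun t : ℝ≥0 => f t) ν' → Integrable (fun t : ℝ≥0 => f t) ν →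
      ∫ t : ℝ≥0, f t ∂ν' ≤ ∫ t : ℝ≥0, f t ∂ν

/-- `ν'` is strictly more variable than `ν`. -/
def StrictlyMoreVariable (ν' ν : Measure ℝ≥0) : Prop := MoreVariable ν' ν ∧ ν' ≠ ν

section Percolation

variable {α : Type u} {β : Type v} (G : Graph α β)

/-! ### First passage percolation -/

/-- The passage time between two vertices for the edge weights `w`. -/
noncomputable def passageTime (w : E(G) → ℝ≥0) (x y : V(G)) : ℝ≥0 :=
  ⨅ p : Path G x y, p.passageTime w

/-- The expected passage time between two vertices when the edge weights are independent with
distribution `ν`. -/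
noncomputable def expectedPassageTime (ν : Measure ℝ≥0) [IsProbabilityMeasure ν] (x y : V(G)) : ℝ :=
  ∫ w : E(G) → ℝ≥0, (passageTime G w x y : ℝ) ∂(Measure.infinitePi fun _ : E(G) => ν)

/-- `𝔼 T' ≪ 𝔼 T`: the limit inferior of `(𝔼 T(x,y) - 𝔼 T'(x,y)) / d(x,y)` as `d(x,y) → ∞` is
positive, where `T'` and `T` are the passage times for the weight distributions `ν'` and `ν`. -/
def AsympStrictlyLess (ν' ν : Measure ℝ≥0) [IsProbabilityMeasure ν'] [IsProbabilityMeasure ν] :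
    Prop :=
  0 < liminf (fun z : V(G) × V(G) =>
      (((expectedPassageTime G ν z.1 z.2 - expectedPassageTime G ν' z.1 z.2) /
        (gdist G z.1 z.2 : ℝ) : ℝ) : EReal))
    (comap (fun z : V(G) × V(G) => gdist G z.1 z.2) atTop)

/-! ### Bernoulli percolation and exponential subcriticality

A configuration is the set `A` of open edges; under `setBernoulli Set.univ p` every edge is open
with probability `p`, independently. -/

/-- There is an open path from `o` to the complement of the ball `B(o, R)`. -/
def escapes (o : V(G)) (R : ℕ) : Set (Set E(G)) :=
  {A | ∃ (y : V(G)) (p : Path G o y), R < gdist G o y ∧ p.edgeSet ⊆ A}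

/-- There is an open path from `o` to the complement of the ball `B(o, R)` which is an
edge-geodesic of `G`. -/
def escapesGeodesically (o : V(G)) (R : ℕ) : Set (Set E(G)) :=
  {A | ∃ (y : V(G)) (p : Path G o y), R < gdist G o y ∧ p.edgeSet ⊆ A ∧ p.IsGeodesic}

/-- The exponential percolation threshold. Here `ENNReal.log 0 = -∞`. -/
noncomputable def expThreshold : unitInterval :=
  sSup {p : unitInterval | limsup (fun R : ℕ => ⨆ o : V(G), ((1 / (R : ℝ) : ℝ) : EReal) *
    ENNReal.log (ProbabilityTheory.setBernoulli Set.univ p (escapes G o R))) atTop < 0}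

/-- The exponential geodesic percolation threshold. -/
noncomputable def expGeodesicThreshold : unitInterval :=
  sSup {p : unitInterval | limsup (fun R : ℕ => ⨆ o : V(G), ((1 / (R : ℝ) : ℝ) : EReal) *
    ENNReal.log (ProbabilityTheory.setBernoulli Set.univ p (escapesGeodesically G o R))) atTop < 0}

/-- Exponential subcriticality of a weight distribution `ν`, in terms of the infimum of the support
of `ν` and the mass that `ν` gives to it. -/
def IsExpSubcritical (ν : Measure ℝ≥0) : Prop :=
  (sInf ν.support = 0 ∧ ν.real {0} < (expThreshold G : ℝ)) ∨
    (0 < sInf ν.support ∧ ν.real {sInf ν.support} < (expGeodesicThreshold G : ℝ))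

/-- The van den Berg-Kesten property. -/
def HasVdBK : Prop :=
  ∀ (ν ν' : Measure ℝ≥0) [IsProbabilityMeasure ν] [IsProbabilityMeasure ν'],
    HasFiniteMean ν → HasFiniteMean ν' → IsExpSubcritical G ν → StrictlyMoreVariable ν' ν →
      AsympStrictlyLess G ν' ν

end Percolation

end FPP

namespace FPP

universe u v

/-! ### Comparison of weight distributions through their truncated means -/

section TruncatedMeans

/-! Variability enters only through the truncated means `s ↦ ∫ min s t`, which are concave and
determine the measure. Comparing that of `ν` with a supporting line of that of `ν'`, at a level
where the two differ, yields an explicit modification of `ν` whose truncated means still dominate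
those of `ν'`: sweep an interval `(p, q)` to its endpoints, or truncate at `p`
(`StrictlyMoreVariable.exists_sweep_or_truncation`). In one edge weight the passage time has the
form `min A (B + t)`, so domination of truncated means compares expectations one edge at a time
(`HasGain.of_minDominated`).

The strict gain comes from detours. Suppose that every competing path can exchange edges `a` for
edges `b` inside a bounded region, with `|b| ≤ (1 + ε) |a|`. Sweeping preserves the mean cost of
each fixed path, but with positive probability it sends `a` to `q` and `b` to `p`, and then the
exchange pays. The gain is uniform over such regions (`StrictlyMoreVariable.exists_hasGain`), and
gains in disjoint regions add (`HasGain.biUnion`).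

The quasi-tree structure supplies regions that no path can avoid: a tree vertex between the images
of `x` and `y` separates them, which gives linearly many distant bottlenecks (`exists_bottlenecks`).
A path through one of them has a piece of fixed length nearby, and that piece has a detour
(`hasDetoursWithin_pathSetsWithin`). These regions do not depend on the minimizing path, so no
subcriticality is needed.

Conversely, a self-avoiding path without `ε`-detours is optimal whenever all weights lie in `[1, 1 +
ε]`, so its expected passage time depends only on the mean weight. Two atomic distributions on this
interval with equal means, one strictly more variable, then violate vdBK; the less variable one is
exponential-subcritical because the geodesic threshold is positive (`expGeodesicThreshold_pos`). -/

/-- The mean of the weight truncated at level `s`. -/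
noncomputable def truncMean (ν : Measure ℝ≥0) (s : ℝ) : ℝ := ∫ t : ℝ≥0, min s (t : ℝ) ∂ν

/-- All truncated means of `ν'`, and its mean, are at most those of `ν`. -/
def MinDominated (ν' ν : Measure ℝ≥0) : Prop :=
  ∀ s : ℝ≥0∞, ∫⁻ t : ℝ≥0, min s (t : ℝ≥0∞) ∂ν' ≤ ∫⁻ t : ℝ≥0, min s (t : ℝ≥0∞) ∂ν

variable (ν ν' : Measure ℝ≥0) [IsProbabilityMeasure ν] [IsProbabilityMeasure ν']

lemma abs_min_coe_le (s : ℝ) (t : ℝ≥0) : |min s (t : ℝ)| ≤ |s| := by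
  rcases le_total s t with h | h
  · rw [min_eq_left h]
  · rw [min_eq_right h, NNReal.abs_eq]; exact h.trans (le_abs_self s)

lemma integrable_min (s : ℝ) : Integrable (fun t : ℝ≥0 => min s (t : ℝ)) ν :=
  Integrable.of_bound (by fun_prop) |s| (ae_of_all _ fun t => abs_min_coe_le s t)

lemma truncMean_zero (ν : Measure ℝ≥0) : truncMean ν 0 = 0 := by
  simp [truncMean]

lemma truncMean_continuous : Continuous (truncMean ν) := by
  refine LipschitzWith.continuous (K := 1) (LipschitzWith.of_dist_le_mul fun s s' => ?_)
  rw [Real.dist_eq, truncMean, truncMean, ← integral_sub (integrable_min ν s) (integrable_min ν s')]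
  have h := norm_integral_le_of_norm_le_const (μ := ν)
    (f := fun t : ℝ≥0 => min s (t : ℝ) - min s' (t : ℝ)) (C := |s - s'|)
    (ae_of_all _ fun t => by
      simpa using abs_min_sub_min_le_max s (t : ℝ) s' (t : ℝ))
  simpa [Real.dist_eq] using h

lemma lintegral_min_ofReal {s : ℝ} (hs : 0 ≤ s) :
    ∫⁻ t : ℝ≥0, min (ENNReal.ofReal s) (t : ℝ≥0∞) ∂ν = ENNReal.ofReal (truncMean ν s) := by
  rw [truncMean, ofReal_integral_eq_lintegral_ofReal (integrable_min ν s)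
    (ae_of_all _ fun t => le_min hs t.2)]
  refine lintegral_congr fun t => ?_
  rw [ENNReal.ofReal_min, ENNReal.ofReal_coe_nnreal]

lemma lintegral_coe_eq_iSup (ν : Measure ℝ≥0) :
    ∫⁻ t : ℝ≥0, (t : ℝ≥0∞) ∂ν = ⨆ n : ℕ, ∫⁻ t : ℝ≥0, min (n : ℝ≥0∞) (t : ℝ≥0∞) ∂ν := by
  rw [← lintegral_iSup (fun n => by fun_prop)]
  · refine lintegral_congr fun t => le_antisymm ?_ (iSup_le fun n => min_le_right _ _)
    obtain ⟨n, hn⟩ := exists_nat_ge t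
    refine le_iSup_of_le n (le_min ?_ le_rfl)
    exact_mod_cast hn
  · intro m n hmn t
    exact min_le_min_right _ (by exact_mod_cast hmn)

/-- The infinite level, which is the mean itself, follows from integer levels by monotone
convergence. -/
lemma MinDominated.of_truncMean_le {ν ν' : Measure ℝ≥0} [IsProbabilityMeasure ν]
    [IsProbabilityMeasure ν'] (h : ∀ s, 0 ≤ s → truncMean ν' s ≤ truncMean ν s) :
    MinDominated ν' ν := by
  have key : ∀ s : ℝ≥0,
      ∫⁻ t : ℝ≥0, min (s : ℝ≥0∞) (t : ℝ≥0∞) ∂ν' ≤ ∫⁻ t : ℝ≥0, min (s : ℝ≥0∞) (t : ℝ≥0∞) ∂ν := by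
    intro s
    rw [← ENNReal.ofReal_coe_nnreal, lintegral_min_ofReal ν' s.coe_nonneg,
      lintegral_min_ofReal ν s.coe_nonneg]
    exact ENNReal.ofReal_le_ofReal (h s s.coe_nonneg)
  intro s
  induction s with
  | top =>
    simp only [le_top, inf_of_le_right]
    rw [lintegral_coe_eq_iSup, lintegral_coe_eq_iSup]
    exact iSup_mono fun n => by simpa using key n
  | coe s => exact key s

/-- The function `min s` is concave and nondecreasing, and it is bounded on the half-line, so it is
an admissible test function without any moment condition. -/
lemma MoreVariable.truncMean_le {ν ν' : Measure ℝ≥0} [IsProbabilityMeasure ν]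
    [IsProbabilityMeasure ν'] (h : MoreVariable ν' ν) (s : ℝ) : truncMean ν' s ≤ truncMean ν s :=
  h (fun t => min s t) ((concaveOn_const s convex_univ).inf (concaveOn_id convex_univ))
    (fun _ _ hab => min_le_min_left _ hab) (integrable_min ν' s) (integrable_min ν s)

/-- The right derivative of `min s t` in `s` is the indicator of `s < t`; the difference quotients
are bounded by `1`, so dominated convergence applies. -/
lemma tendsto_truncMean_slope (s : ℝ) :
    Tendsto (fun n : ℕ => ((n : ℝ) + 1) * (truncMean ν (s + 1 / ((n : ℝ) + 1)) - truncMean ν s))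
      atTop (nhds (ν.real {t : ℝ≥0 | s < t})) := by
  have hm : MeasurableSet {t : ℝ≥0 | s < t} := measurableSet_lt measurable_const (by fun_prop)
  rw [← integral_indicator_one hm]
  have heq : ∀ n : ℕ, ((n : ℝ) + 1) * (truncMean ν (s + 1 / ((n : ℝ) + 1)) - truncMean ν s) =
      ∫ t : ℝ≥0, ((n : ℝ) + 1) * (min (s + 1 / ((n : ℝ) + 1)) (t : ℝ) - min s (t : ℝ)) ∂ν := by
    intro n
    rw [integral_const_mul, integral_sub (integrable_min ν _) (integrable_min ν _)]; rfl
  simp_rw [heq]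
  refine tendsto_integral_of_dominated_convergence (fun _ => (1 : ℝ)) ?_ (integrable_const 1) ?_ ?_
  · intro n; exact Measurable.aestronglyMeasurable (by fun_prop)
  · intro n
    refine ae_of_all _ fun t => ?_
    have hn : (0 : ℝ) < (n : ℝ) + 1 := by positivity
    have h1 : |min (s + 1 / ((n : ℝ) + 1)) (t : ℝ) - min s (t : ℝ)| ≤ 1 / ((n : ℝ) + 1) := by
      refine (abs_min_sub_min_le_max _ _ _ _).trans ?_
      simp [abs_of_pos hn, hn.le]
    rw [Real.norm_eq_abs, abs_mul, abs_of_pos hn]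
    calc ((n : ℝ) + 1) * _ ≤ ((n : ℝ) + 1) * (1 / ((n : ℝ) + 1)) := by gcongr
      _ = 1 := by field_simp
  · refine ae_of_all _ fun t => ?_
    by_cases ht : s < t
    · have h0 : Tendsto (fun n : ℕ => s + 1 / ((n : ℝ) + 1)) atTop (nhds (s + 0)) :=
        tendsto_const_nhds.add tendsto_one_div_add_atTop_nhds_zero_nat
      rw [add_zero] at h0
      refine tendsto_const_nhds.congr' ?_
      filter_upwards [h0.eventually (eventually_lt_nhds ht)] with n hn
      have hn' : (0 : ℝ) < (n : ℝ) + 1 := by positivity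
      rw [Set.indicator_of_mem (by exact ht), min_eq_left hn.le, min_eq_left ht.le]
      simp only [Pi.one_apply]; field_simp; ring
    · refine tendsto_const_nhds.congr fun n => ?_
      have hn' : (0 : ℝ) < 1 / ((n : ℝ) + 1) := by positivity
      push Not at ht
      rw [Set.indicator_of_notMem (by simpa using ht), min_eq_right (by linarith), min_eq_right ht]
      simp

/-- Right derivatives of the truncated means are the tails, hence give the distribution function. -/
lemma eq_of_truncMean_eq {ν ν' : Measure ℝ≥0} [IsProbabilityMeasure ν] [IsProbabilityMeasure ν']
    (h : ∀ s, 0 ≤ s → truncMean ν' s = truncMean ν s) : ν' = ν := by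
  refine Measure.ext_of_Iic _ _ fun a => ?_
  have h1 : ν'.real {t : ℝ≥0 | (a : ℝ) < t} = ν.real {t : ℝ≥0 | (a : ℝ) < t} := by
    refine tendsto_nhds_unique (tendsto_truncMean_slope ν' a) ?_
    refine (tendsto_truncMean_slope ν a).congr fun n => ?_
    rw [h _ a.coe_nonneg, h _ (add_nonneg a.coe_nonneg (by positivity))]
  have h2 : {t : ℝ≥0 | (a : ℝ) < t} = (Set.Iic a)ᶜ := by ext t; simp
  rw [h2, probReal_compl_eq_one_sub measurableSet_Iic,
    probReal_compl_eq_one_sub measurableSet_Iic] at h1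
  exact (measureReal_eq_measureReal_iff).1 (by linarith)

/-- A supporting line of the concave function `truncMean ν`. -/
lemma truncMean_le_line (s₀ s : ℝ) :
    truncMean ν s ≤ truncMean ν s₀ + ν.real {t : ℝ≥0 | s₀ < t} * (s - s₀) := by
  have hm : MeasurableSet {t : ℝ≥0 | s₀ < t} := measurableSet_lt measurable_const (by fun_prop)
  have hi : Integrable (fun t : ℝ≥0 => ({t : ℝ≥0 | s₀ < t}.indicator 1 t : ℝ) * (s - s₀)) ν :=
    ((integrable_indicator_iff hm).2 (integrable_const 1).integrableOn).mul_const _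
  rw [← integral_indicator_one hm, ← integral_mul_const, truncMean, truncMean,
    ← integral_add (integrable_min ν s₀) hi]
  refine integral_mono (integrable_min ν s) ((integrable_min ν s₀).add hi) fun t => ?_
  by_cases ht : s₀ < t
  · rw [Set.indicator_of_mem (by exact ht), min_eq_left ht.le]
    simp
  · rw [Set.indicator_of_notMem (by simpa using ht), min_eq_right (not_lt.1 ht)]
    simp

end TruncatedMeans

/-! ### Sweeping an interval to its endpoints, and truncation -/

section Sweeping

/-- The uniform distribution on `[0, 1)`. -/
noncomputable def unif : Measure ℝ := volume.restrict (Set.Ico 0 1)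

instance : IsProbabilityMeasure unif := ⟨by simp [unif]⟩

lemma unif_Iio {τ : ℝ} (h1 : τ ≤ 1) : unif (Set.Iio τ) = ENNReal.ofReal τ := by
  have : Set.Iio τ ∩ Set.Ico 0 1 = Set.Ico 0 τ := by
    ext u; simp only [Set.mem_inter_iff, Set.mem_Iio, Set.mem_Ico]; constructor
    · rintro ⟨a, b, c⟩; exact ⟨b, a⟩
    · rintro ⟨a, b⟩; exact ⟨b, a, b.trans_le h1⟩
  rw [unif, Measure.restrict_apply measurableSet_Iio, this]; simp

lemma unif_Ici {τ : ℝ} (h0 : 0 ≤ τ) : unif (Set.Ici τ) = ENNReal.ofReal (1 - τ) := by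
  have : Set.Ici τ ∩ Set.Ico 0 1 = Set.Ico τ 1 := by
    ext u; simp only [Set.mem_inter_iff, Set.mem_Ici, Set.mem_Ico]; constructor
    · rintro ⟨a, b, c⟩; exact ⟨a, c⟩
    · rintro ⟨a, b⟩; exact ⟨a, h0.trans a, b⟩
  rw [unif, Measure.restrict_apply measurableSet_Ici, this]; simp

/-- Sweep a point `t` of the interval `(p, q)` to one of the endpoints, preserving the mean when
`u` is uniform on `[0, 1)`. -/
noncomputable def sweep (p q t : ℝ≥0) (u : ℝ) : ℝ≥0 :=
  if p < t ∧ t < q then (if u < ((t : ℝ) - p) / ((q : ℝ) - p) then q else p) else t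

lemma measurable_sweep (p q : ℝ≥0) : Measurable fun z : ℝ≥0 × ℝ => sweep p q z.1 z.2 := by
  unfold sweep
  refine Measurable.ite ?_ (Measurable.ite ?_ measurable_const measurable_const) measurable_fst
  · exact measurable_fst (measurableSet_Ioo (a := p) (b := q))
  · exact measurableSet_lt measurable_snd (by fun_prop)

/-- The image of `ν` under sweeping the interval `(p, q)` to its endpoints. -/
noncomputable def sweepMeasure (ν : Measure ℝ≥0) (p q : ℝ≥0) : Measure ℝ≥0 :=
  (ν.prod unif).map fun z : ℝ≥0 × ℝ => sweep p q z.1 z.2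

variable (ν ν' : Measure ℝ≥0) [IsProbabilityMeasure ν] [IsProbabilityMeasure ν']

instance (p q : ℝ≥0) : IsProbabilityMeasure (sweepMeasure ν p q) :=
  Measure.isProbabilityMeasure_map (measurable_sweep p q).aemeasurable

lemma integral_min_sweep_of_mem {p q t : ℝ≥0} (h1 : p < t) (h2 : t < q) (s : ℝ) :
    ∫ u, min s (sweep p q t u : ℝ) ∂unif =
      ((t : ℝ) - p) / ((q : ℝ) - p) * (min s q - min s p) + min s p := by
  have h1' : (p : ℝ) < t := h1
  have h2' : (t : ℝ) < q := h2
  set τ : ℝ := ((t : ℝ) - p) / ((q : ℝ) - p) with hτ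
  have hτ0 : 0 ≤ τ := div_nonneg (by linarith) (by linarith)
  have hτ1 : τ ≤ 1 := by rw [hτ, div_le_one (by linarith)]; linarith
  have heq : ∀ u, min s (sweep p q t u : ℝ) =
      (Set.Iio τ).indicator (fun _ => min s (q : ℝ) - min s (p : ℝ)) u + min s (p : ℝ) := by
    intro u
    simp only [sweep, h1, h2, and_self, if_true, Set.indicator_apply, Set.mem_Iio, ← hτ]
    split_ifs <;> simp
  simp_rw [heq]
  rw [integral_add ((integrable_const _).indicator measurableSet_Iio) (integrable_const _),
    integral_indicator_const _ measurableSet_Iio, Measure.real, unif_Iio hτ1,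
    ENNReal.toReal_ofReal hτ0]
  simp

lemma integral_min_sweep_of_notMem {p q t : ℝ≥0} (h : ¬ (p < t ∧ t < q)) (s : ℝ) :
    ∫ u, min s (sweep p q t u : ℝ) ∂unif = min s t := by
  simp [sweep, h]

lemma truncMean_sweepMeasure (p q : ℝ≥0) (s : ℝ) :
    truncMean (sweepMeasure ν p q) s = ∫ t, ∫ u, min s (sweep p q t u : ℝ) ∂unif ∂ν := by
  have hm : AEStronglyMeasurable (fun t : ℝ≥0 => min s (t : ℝ)) (sweepMeasure ν p q) :=
    Measurable.aestronglyMeasurable (by fun_prop)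
  rw [truncMean, sweepMeasure, integral_map (measurable_sweep p q).aemeasurable hm]
  refine integral_prod (fun z : ℝ≥0 × ℝ => min s (sweep p q z.1 z.2 : ℝ)) ?_
  have := (measurable_sweep p q)
  exact Integrable.of_bound (Measurable.aestronglyMeasurable (by fun_prop)) |s|
    (ae_of_all _ fun z => abs_min_coe_le s _)

/-- For such `s` the function `min s` is affine on `[p, q]`, and sweeping preserves means of affine
functions. -/
lemma truncMean_sweepMeasure_of_notMem {p q : ℝ≥0} {s : ℝ} (hs : s ≤ p ∨ q ≤ s) :
    truncMean (sweepMeasure ν p q) s = truncMean ν s := by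
  rw [truncMean_sweepMeasure, truncMean]
  refine integral_congr_ae (ae_of_all _ fun t => ?_)
  by_cases ht : p < t ∧ t < q
  · have h1 : (p : ℝ) < t := ht.1
    have h2 : (t : ℝ) < q := ht.2
    simp only
    rw [integral_min_sweep_of_mem ht.1 ht.2]
    rcases hs with hs | hs
    · rw [min_eq_left hs, min_eq_left (by linarith), min_eq_left (by linarith)]; ring
    · rw [min_eq_right hs, min_eq_right (by linarith), min_eq_right (by linarith)]
      have : (q : ℝ) - p ≠ 0 := by linarith
      field_simp; ring
  · exact integral_min_sweep_of_notMem ht s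

lemma min_convexComb_eq {p q t : ℝ≥0} (hpq : p < q) (ht : ¬ (p < t ∧ t < q)) {θ : ℝ}
    (h0 : 0 ≤ θ) (h1 : θ ≤ 1) :
    min ((1 - θ) * p + θ * q) (t : ℝ) = (1 - θ) * min (p : ℝ) t + θ * min (q : ℝ) t := by
  have hpq' : (p : ℝ) < q := hpq
  have a : 0 ≤ θ * ((q : ℝ) - p) := mul_nonneg h0 (by linarith)
  have b : 0 ≤ (1 - θ) * ((q : ℝ) - p) := mul_nonneg (by linarith) (by linarith)
  by_cases h : p < t
  · have h2 : (q : ℝ) ≤ t := by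
      have := not_lt.1 fun h' => ht ⟨h, h'⟩
      exact_mod_cast this
    rw [min_eq_left (by nlinarith), min_eq_left (by linarith), min_eq_left h2]
  · have h2 : (t : ℝ) ≤ p := by exact_mod_cast not_lt.1 h
    rw [min_eq_right (by nlinarith), min_eq_right (by linarith), min_eq_right (by linarith)]
    ring

/-- Sweeping replaces the graph of `truncMean ν` over `[p, q]` by its chord, since no mass is left
strictly inside. -/
lemma truncMean_sweepMeasure_convexComb {p q : ℝ≥0} (hpq : p < q) {θ : ℝ} (h0 : 0 ≤ θ)
    (h1 : θ ≤ 1) :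
    truncMean (sweepMeasure ν p q) ((1 - θ) * p + θ * q) =
      (1 - θ) * truncMean ν p + θ * truncMean ν q := by
  have hpq' : (p : ℝ) < q := hpq
  rw [truncMean_sweepMeasure, truncMean, truncMean, ← integral_const_mul, ← integral_const_mul,
    ← integral_add ((integrable_min ν _).const_mul _) ((integrable_min ν _).const_mul _)]
  refine integral_congr_ae (ae_of_all _ fun t => ?_)
  by_cases ht : p < t ∧ t < q
  · have h1' : (p : ℝ) < t := ht.1
    have h2' : (t : ℝ) < q := ht.2
    simp only
    have a : 0 ≤ θ * ((q : ℝ) - p) := mul_nonneg h0 (by linarith)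
    have b : 0 ≤ (1 - θ) * ((q : ℝ) - p) := mul_nonneg (by linarith) (by linarith)
    rw [integral_min_sweep_of_mem ht.1 ht.2, min_eq_left h1'.le, min_eq_right h2'.le,
      min_eq_left (by linarith), min_eq_right (by linarith)]
    have : (q : ℝ) - p ≠ 0 := by linarith
    field_simp; ring
  · simp only
    rw [integral_min_sweep_of_notMem ht, min_convexComb_eq hpq ht h0 h1]

lemma truncMean_map_min (ν : Measure ℝ≥0) (p : ℝ≥0) (s : ℝ) :
    truncMean (ν.map (min p)) s = truncMean ν (min s p) := by
  have hm : Measurable (min p : ℝ≥0 → ℝ≥0) := measurable_const.min measurable_id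
  rw [truncMean, integral_map hm.aemeasurable (Measurable.aestronglyMeasurable (by fun_prop)),
    truncMean]
  simp [min_assoc]

lemma measure_Ioo_ne_zero_of_truncMean_lt {p q : ℝ≥0} (hpq : p < q) {θ : ℝ} (h0 : 0 ≤ θ)
    (h1 : θ ≤ 1)
    (h : (1 - θ) * truncMean ν p + θ * truncMean ν q < truncMean ν ((1 - θ) * p + θ * q)) :
    ν (Set.Ioo p q) ≠ 0 := by
  intro h0'
  refine h.ne ?_
  rw [truncMean, truncMean, truncMean, ← integral_const_mul, ← integral_const_mul,
    ← integral_add ((integrable_min ν _).const_mul _) ((integrable_min ν _).const_mul _)]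
  refine integral_congr_ae ?_
  filter_upwards [measure_eq_zero_iff_ae_notMem.1 h0'] with t ht
  exact (min_convexComb_eq hpq ht h0 h1).symm

lemma measure_Ioi_ne_zero_of_truncMean_lt (ν : Measure ℝ≥0) {p : ℝ≥0} {s : ℝ} (hs : p ≤ s)
    (h : truncMean ν p < truncMean ν s) : ν (Set.Ioi p) ≠ 0 := by
  intro h0
  refine h.ne (integral_congr_ae ?_)
  filter_upwards [measure_eq_zero_iff_ae_notMem.1 h0] with t ht
  have : (t : ℝ) ≤ p := by simpa using ht
  rw [min_eq_right this, min_eq_right (this.trans hs)]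

lemma truncMean_le_mean (hν : HasFiniteMean ν) (s : ℝ) : truncMean ν s ≤ ∫ t : ℝ≥0, (t : ℝ) ∂ν :=
  integral_mono (integrable_min ν s) hν fun _ => min_le_right _ _

variable {ν ν'}

/-- If `ν'` is strictly more variable than `ν`, then one can modify `ν` in one explicit way and
stay below `ν'`: either sweep an interval to its endpoints, or truncate. -/
theorem StrictlyMoreVariable.exists_sweep_or_truncation (hν : HasFiniteMean ν)
    (h : StrictlyMoreVariable ν' ν) :
    (∃ p q : ℝ≥0, p < q ∧ ν (Set.Ioo p q) ≠ 0 ∧ MinDominated ν' (sweepMeasure ν p q)) ∨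
      ∃ p : ℝ≥0, ν (Set.Ioi p) ≠ 0 ∧ MinDominated ν' (ν.map (min p)) := by
  obtain ⟨s₀, hs₀, hlt⟩ : ∃ s, 0 ≤ s ∧ truncMean ν' s < truncMean ν s := by
    by_contra! hcon
    exact h.2 (eq_of_truncMean_eq fun s hs => le_antisymm (h.1.truncMean_le s) (hcon s hs))
  -- The line `ℓ` lies above `truncMean ν'` everywhere and strictly below `truncMean ν` at `s₀`. The
  -- endpoints `p` and `q` will be points where `ℓ` meets `truncMean ν` on either side of `s₀`.
  set ρ := ν'.real {t : ℝ≥0 | s₀ < t} with hρ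
  set ℓ : ℝ → ℝ := fun s => truncMean ν' s₀ + ρ * (s - s₀) with hℓ
  have hle : ∀ s, truncMean ν' s ≤ ℓ s := truncMean_le_line ν' s₀
  have hcont : Continuous fun s => ℓ s - truncMean ν s :=
    (by fun_prop : Continuous ℓ).sub (truncMean_continuous ν)
  have hf0 : 0 ≤ ℓ 0 - truncMean ν 0 := by
    have := hle 0
    rw [truncMean_zero] at this ⊢
    linarith
  have hfs : ℓ s₀ - truncMean ν s₀ < 0 := by simp only [hℓ]; linarith
  obtain ⟨p, ⟨hp0, hps⟩, hp⟩ := intermediate_value_Icc' hs₀ hcont.continuousOn ⟨hfs.le, hf0⟩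
  simp only at hp
  have hps' : p < s₀ := lt_of_le_of_ne hps fun h => by rw [← h] at hfs; linarith
  lift p to ℝ≥0 using hp0
  -- If `ℓ` catches up with `truncMean ν` again, sweep: the new truncated mean is `ℓ` between `p`
  -- and `q` and is unchanged elsewhere, so it dominates that of `ν'`. Otherwise `ℓ` is horizontal,
  -- and truncating at `p` freezes the truncated mean at the height of `ℓ`.
  by_cases hq : ∃ q, s₀ < q ∧ truncMean ν q ≤ ℓ q
  · left
    obtain ⟨q₁, hq₁, hq₁'⟩ := hq
    obtain ⟨q, ⟨hqs, -⟩, hq⟩ := intermediate_value_Icc hq₁.le hcont.continuousOn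
      ⟨hfs.le, sub_nonneg.2 hq₁'⟩
    simp only at hq
    have hqs' : s₀ < q := lt_of_le_of_ne hqs fun h => by rw [h] at hfs; linarith
    lift q to ℝ≥0 using hs₀.trans hqs
    have hpq : (p : ℝ) < q := hps'.trans hqs'
    have comb : ∀ s : ℝ, p ≤ s → s ≤ q → ∃ θ : ℝ, 0 ≤ θ ∧ θ ≤ 1 ∧ s = (1 - θ) * p + θ * q ∧
        (1 - θ) * truncMean ν p + θ * truncMean ν q = ℓ s := by
      intro s h1 h2
      refine ⟨(s - p) / (q - p), div_nonneg (by linarith) (by linarith),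
        (div_le_one (by linarith)).2 (by linarith), ?_, ?_⟩
      · have : (q : ℝ) - p ≠ 0 := by linarith
        field_simp; ring
      · have : (q : ℝ) - p ≠ 0 := by linarith
        rw [show truncMean ν p = ℓ p by linarith, show truncMean ν q = ℓ q by linarith]
        simp only [hℓ]
        field_simp; ring
    refine ⟨p, q, hpq, ?_, MinDominated.of_truncMean_le fun s hs => ?_⟩
    · obtain ⟨θ, h0, h1, h2, h3⟩ := comb s₀ hps hqs
      refine measure_Ioo_ne_zero_of_truncMean_lt ν hpq h0 h1 ?_
      rw [h3, ← h2]; linarith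
    · by_cases hs' : s ≤ p ∨ q ≤ s
      · rw [truncMean_sweepMeasure_of_notMem ν hs']
        exact h.1.truncMean_le s
      · push Not at hs'
        obtain ⟨θ, h0, h1, h2, h3⟩ := comb s hs'.1.le hs'.2.le
        rw [h2, truncMean_sweepMeasure_convexComb ν hpq h0 h1, h3, ← h2]
        exact hle s
  · right
    push Not at hq
    -- With positive slope, `ℓ` would exceed the finite mean of `ν`, an upper bound for `truncMean
    -- ν`; `b` is far enough to see this.
    have hρ0 : ρ = 0 := by
      by_contra hne
      have hpos : 0 < ρ := lt_of_le_of_ne measureReal_nonneg (Ne.symm hne)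
      set m := ∫ t : ℝ≥0, (t : ℝ) ∂ν with hm
      set b := max 1 ((m - truncMean ν' s₀) / ρ) with hb
      have hb1 : 1 ≤ b := le_max_left _ _
      have hb2 : m - truncMean ν' s₀ ≤ ρ * b := by
        have := le_max_right 1 ((m - truncMean ν' s₀) / ρ)
        rw [← hb, div_le_iff₀ hpos] at this
        linarith
      have h1 := hq (s₀ + b) (by linarith)
      have h2 := truncMean_le_mean ν hν (s₀ + b)
      simp only [hℓ, add_sub_cancel_left] at h1
      linarith
    have hp' : truncMean ν p = truncMean ν' s₀ := by
      simp only [hℓ, hρ0] at hp; linarith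
    have hle' : ∀ s, truncMean ν' s ≤ truncMean ν' s₀ := fun s => by
      have := hle s
      simp only [hℓ, hρ0] at this; linarith
    refine ⟨p, measure_Ioi_ne_zero_of_truncMean_lt ν hps (hp' ▸ hlt), ?_⟩
    have : IsProbabilityMeasure (ν.map (min p)) :=
      Measure.isProbabilityMeasure_map (measurable_const.min measurable_id).aemeasurable
    refine MinDominated.of_truncMean_le fun s hs => ?_
    rw [truncMean_map_min]
    rcases le_total s p with hsp | hsp
    · rw [min_eq_left hsp]; exact h.1.truncMean_le s
    · rw [min_eq_right hsp, hp']; exact hle' s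

end Sweeping

/-! ### Minimal cost over a family of finite sets -/

section MinCost

variable {E : Type*}

/-- The least total weight of a member of the family `𝒮`. -/
noncomputable def minCost (𝒮 : Set (Finset E)) (w : E → ℝ≥0) : ℝ≥0∞ :=
  ⨅ S ∈ 𝒮, ∑ e ∈ S, (w e : ℝ≥0∞)

lemma minCost_le {𝒮 : Set (Finset E)} {S : Finset E} (hS : S ∈ 𝒮) (w : E → ℝ≥0) :
    minCost 𝒮 w ≤ ∑ e ∈ S, (w e : ℝ≥0∞) := iInf₂_le S hS

lemma measurable_minCost [Countable E] (𝒮 : Set (Finset E)) : Measurable (minCost 𝒮) := by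
  refine Measurable.biInf 𝒮 𝒮.to_countable fun S _ => ?_
  exact Finset.measurable_fun_sum S fun e _ => (measurable_pi_apply e).coe_nnreal_ennreal

/-- The region `R` contains detours for all members of `𝒮`: part of `S` can be exchanged for a set
that is hardly larger. -/
def HasDetoursWithin (ε : ℝ) (𝒮 : Set (Finset E)) (R : Finset E) : Prop :=
  ∀ S ∈ 𝒮, ∃ a b : Finset E, a ⊆ S ∧ a ⊆ R ∧ b ⊆ R ∧ Disjoint a b ∧ a.Nonempty ∧
    (b.card : ℝ) ≤ (1 + ε) * a.card ∧
    ∃ S' ∈ 𝒮, ∀ w : E → ℝ≥0,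
      ∑ e ∈ S', (w e : ℝ≥0∞) + ∑ e ∈ a, (w e : ℝ≥0∞) ≤
        ∑ e ∈ S, (w e : ℝ≥0∞) + ∑ e ∈ b, (w e : ℝ≥0∞)

variable [DecidableEq E]

/-- Replacing `ν` by `ν'` on the coordinates in `s` lowers the expectation of `T` by at least `c`,
whatever the other coordinates are. -/
def HasGain (T : (E → ℝ≥0) → ℝ≥0∞) (ν' ν : Measure ℝ≥0) (s : Finset E) (c : ℝ≥0∞) : Prop :=
  ∀ x, (∫⋯∫⁻_s, T ∂fun _ => ν') x + c ≤ (∫⋯∫⁻_s, T ∂fun _ => ν) x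

lemma lmarginal_congr_measure {μ μ' : E → Measure ℝ≥0} {s : Finset E}
    (h : ∀ e ∈ s, μ e = μ' e) (f : (E → ℝ≥0) → ℝ≥0∞) : (∫⋯∫⁻_s, f ∂μ) = ∫⋯∫⁻_s, f ∂μ' := by
  ext x
  have : (fun i : s => μ i) = fun i : s => μ' i := funext fun i => h i i.2
  rw [lmarginal, lmarginal, this]

lemma lmarginal_add_const (μ : E → Measure ℝ≥0) [∀ e, IsProbabilityMeasure (μ e)] (s : Finset E)
    (f : (E → ℝ≥0) → ℝ≥0∞) (c : ℝ≥0∞) (x : E → ℝ≥0) :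
    (∫⋯∫⁻_s, (fun y => f y + c) ∂μ) x = (∫⋯∫⁻_s, f ∂μ) x + c := by
  rw [lmarginal, lintegral_add_right _ measurable_const]
  simp [lmarginal]

variable {T : (E → ℝ≥0) → ℝ≥0∞} {ν ν' ν'' : Measure ℝ≥0}

lemma HasGain.trans {s : Finset E} {c d : ℝ≥0∞} (h₁ : HasGain T ν'' ν' s c)
    (h₂ : HasGain T ν' ν s d) : HasGain T ν'' ν s (c + d) := fun x => by
  rw [← add_assoc]
  exact (add_le_add_left (h₁ x) d).trans (h₂ x)

lemma HasGain.mono {s : Finset E} {c d : ℝ≥0∞} (h : HasGain T ν' ν s c) (hd : d ≤ c) :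
    HasGain T ν' ν s d := fun x => (add_le_add_right hd _).trans (h x)

lemma HasGain.empty : HasGain T ν' ν ∅ 0 := fun x => by simp

variable [IsProbabilityMeasure ν] [IsProbabilityMeasure ν']

lemma lmarginal_comm_of_disjoint (hT : Measurable T) {s t : Finset E} (hst : Disjoint s t) :
    (∫⋯∫⁻_s, ∫⋯∫⁻_t, T ∂(fun _ => ν) ∂fun _ => ν') =
      ∫⋯∫⁻_t, ∫⋯∫⁻_s, T ∂(fun _ => ν') ∂fun _ => ν := by
  -- A single product measure, with `ν` on `t` and `ν'` elsewhere, turns both sides into its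
  -- marginal over `s ∪ t`.
  set μ : E → Measure ℝ≥0 := fun e => if e ∈ t then ν else ν' with hμ
  have hp : ∀ e, IsProbabilityMeasure (μ e) := fun e => by
    simp only [hμ]; split_ifs <;> infer_instance
  have h1 : ∀ f : (E → ℝ≥0) → ℝ≥0∞, (∫⋯∫⁻_t, f ∂fun _ => ν) = ∫⋯∫⁻_t, f ∂μ := fun f =>
    lmarginal_congr_measure (fun e he => by simp [hμ, he]) f
  have h2 : ∀ f : (E → ℝ≥0) → ℝ≥0∞, (∫⋯∫⁻_s, f ∂fun _ => ν') = ∫⋯∫⁻_s, f ∂μ := fun f =>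
    lmarginal_congr_measure (fun e he => by
      simp [hμ, Finset.disjoint_left.1 hst he]) f
  rw [h1, h1, h2, h2, ← lmarginal_union μ T hT hst, ← lmarginal_union' μ T hT hst]

/-- Switch the measure first on `t`, then on `s`. A gain holds for all values of the remaining
coordinates, so it survives averaging over them. -/
lemma HasGain.union (hT : Measurable T) {s t : Finset E} (hst : Disjoint s t) {c d : ℝ≥0∞}
    (hs : HasGain T ν' ν s c) (ht : HasGain T ν' ν t d) : HasGain T ν' ν (s ∪ t) (c + d) := by
  intro x
  rw [lmarginal_union _ T hT hst, lmarginal_union' _ T hT hst, add_comm c d, ← add_assoc,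
    ← lmarginal_add_const]
  calc (∫⋯∫⁻_s, (fun y => (∫⋯∫⁻_t, T ∂fun _ => ν') y + d) ∂fun _ => ν') x + c
      ≤ (∫⋯∫⁻_s, ∫⋯∫⁻_t, T ∂(fun _ => ν) ∂fun _ => ν') x + c :=
        add_le_add_left (lmarginal_mono (fun y => ht y) x) _
    _ = (∫⋯∫⁻_t, (fun y => (∫⋯∫⁻_s, T ∂fun _ => ν') y + c) ∂fun _ => ν) x := by
        rw [lmarginal_comm_of_disjoint hT hst, lmarginal_add_const]
    _ ≤ (∫⋯∫⁻_t, ∫⋯∫⁻_s, T ∂(fun _ => ν) ∂fun _ => ν) x := lmarginal_mono (fun y => hs y) x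

lemma HasGain.biUnion (hT : Measurable T) {ι : Type*} [DecidableEq ι] (I : Finset ι)
    (R : ι → Finset E) (hd : (I : Set ι).PairwiseDisjoint R) {c : ℝ≥0∞}
    (h : ∀ i ∈ I, HasGain T ν' ν (R i) c) : HasGain T ν' ν (I.biUnion R) (I.card * c) := by
  induction I using Finset.induction_on with
  | empty => simpa using HasGain.empty
  | insert i I hi ih =>
    rw [Finset.biUnion_insert, Finset.card_insert_of_notMem hi, Nat.cast_succ, add_mul, one_mul,
      add_comm]
    refine HasGain.union hT ?_ (h i (Finset.mem_insert_self i I))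
      (ih (hd.subset (by simp)) fun j hj => h j (Finset.mem_insert_of_mem hj))
    rw [Finset.disjoint_biUnion_right]
    intro j hj
    exact hd (by simp) (by simp [hj]) (by rintro rfl; exact hi hj)

lemma sum_update_eq (S : Finset E) (x : E → ℝ≥0) (e : E) (t : ℝ≥0) :
    ∑ i ∈ S, (Function.update x e t i : ℝ≥0∞) =
      if e ∈ S then ∑ i ∈ S.erase e, (x i : ℝ≥0∞) + t else ∑ i ∈ S, (x i : ℝ≥0∞) := by
  have hne : ∀ S : Finset E, e ∉ S →
      ∑ i ∈ S, (Function.update x e t i : ℝ≥0∞) = ∑ i ∈ S, (x i : ℝ≥0∞) := fun S hS =>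
    Finset.sum_congr rfl fun i hi => by
      rw [Function.update_of_ne (by rintro rfl; exact hS hi)]
  split_ifs with h
  · rw [← Finset.sum_erase_add _ _ h, hne _ (Finset.notMem_erase e S), Function.update_self]
  · exact hne S h

/-- Here `A` is the least cost of a set avoiding `e`, and `B` the least cost of a set through `e`
with `e` itself left out. -/
lemma minCost_update (𝒮 : Set (Finset E)) (x : E → ℝ≥0) (e : E) :
    ∃ A B : ℝ≥0∞, ∀ t, minCost 𝒮 (Function.update x e t) = min A (B + t) := by
  refine ⟨⨅ S ∈ {S ∈ 𝒮 | e ∉ S}, ∑ i ∈ S, (x i : ℝ≥0∞),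
    ⨅ S ∈ {S ∈ 𝒮 | e ∈ S}, ∑ i ∈ S.erase e, (x i : ℝ≥0∞), fun t => ?_⟩
  refine le_antisymm (le_min (le_iInf₂ fun S hS => ?_) ?_) (le_iInf₂ fun S hS => ?_)
  · refine (minCost_le hS.1 _).trans ?_
    rw [sum_update_eq, if_neg hS.2]
  · simp only [ENNReal.iInf_add]
    refine le_iInf₂ fun S hS => (minCost_le hS.1 _).trans ?_
    rw [sum_update_eq, if_pos hS.2]
  · rw [sum_update_eq]
    split_ifs with h
    · exact min_le_of_right_le (add_le_add_left (iInf₂_le S ⟨hS, h⟩) _)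
    · exact min_le_of_left_le (iInf₂_le S ⟨hS, h⟩)

/-- For `B ≤ A` the integrand is `B + min (A - B) t`. The level `A - B` is infinite when `A` is and
`B` is not, so `MinDominated` must include the level `⊤`. -/
lemma MinDominated.lintegral_min_add_le (h : MinDominated ν' ν) (A B : ℝ≥0∞) :
    ∫⁻ t : ℝ≥0, min A (B + t) ∂ν' ≤ ∫⁻ t : ℝ≥0, min A (B + t) ∂ν := by
  rcases le_total A B with hAB | hAB
  · have : ∀ t : ℝ≥0, min A (B + t) = A := fun t => min_eq_left (hAB.trans le_self_add)
    simp [this]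
  · have : ∀ t : ℝ≥0, min A (B + t) = B + min (A - B) t := fun t => by
      rw [← min_add_add_left, add_tsub_cancel_of_le hAB]
    simp_rw [this]
    rw [lintegral_add_left measurable_const, lintegral_add_left measurable_const]
    simpa using add_le_add_right (h (A - B)) B

/-- Each single coordinate has gain `0`; these trivial gains are combined over the disjoint
singletons. -/
lemma HasGain.of_minDominated [Countable E] (h : MinDominated ν' ν) (𝒮 : Set (Finset E))
    (s : Finset E) : HasGain (minCost 𝒮) ν' ν s 0 := by
  have := HasGain.biUnion (ν := ν) (ν' := ν') (measurable_minCost 𝒮) s (fun e => {e})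
    (by intro i _ j _ hij; simpa using hij) (c := 0) fun e _ x => ?_
  · simpa using this
  · rw [lmarginal_singleton, lmarginal_singleton, add_zero]
    obtain ⟨A, B, hAB⟩ := minCost_update 𝒮 x e
    simp_rw [hAB]
    exact h.lintegral_min_add_le A B

end MinCost

/-! ### The gain from one region containing detours -/

section RegionGain

lemma lintegral_sweep (p q t : ℝ≥0) : ∫⁻ u, (sweep p q t u : ℝ≥0∞) ∂unif = t := by
  by_cases ht : p < t ∧ t < q
  · have h1 : (p : ℝ) < t := ht.1
    have h2 : (t : ℝ) < q := ht.2
    have hle : ∀ u, (sweep p q t u : ℝ) ≤ q := fun u => by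
      simp only [sweep, ht, and_self, if_true]
      split_ifs
      · exact le_rfl
      · linarith
    have hm : Measurable fun u => sweep p q t u :=
      (measurable_sweep p q).comp (measurable_const.prodMk measurable_id)
    have hi : Integrable (fun u => (sweep p q t u : ℝ)) unif :=
      Integrable.of_bound (Measurable.aestronglyMeasurable (by fun_prop)) (q : ℝ)
        (ae_of_all _ fun u => by rw [Real.norm_eq_abs, NNReal.abs_eq]; exact hle u)
    have h3 : ∫ u, (sweep p q t u : ℝ) ∂unif = t := by
      have := integral_min_sweep_of_mem ht.1 ht.2 (q : ℝ)
      simp_rw [min_eq_right (hle _)] at this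
      rw [this, min_self, min_eq_right (by linarith)]
      have : (q : ℝ) - p ≠ 0 := by linarith
      field_simp; ring
    have h4 := ofReal_integral_eq_lintegral_ofReal hi (ae_of_all _ fun u => NNReal.coe_nonneg _)
    rw [h3] at h4
    simpa using h4.symm
  · simp [sweep, ht]

/-- The weights in `(p, q)` which are swept to either endpoint with probability at least `δ`. -/
def sweepCore (p q : ℝ≥0) (δ : ℝ) : Set ℝ≥0 :=
  {t | (p < t ∧ t < q) ∧
    δ ≤ ((t : ℝ) - p) / ((q : ℝ) - p) ∧ ((t : ℝ) - p) / ((q : ℝ) - p) ≤ 1 - δ}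

lemma measurableSet_sweepCore (p q : ℝ≥0) (δ : ℝ) : MeasurableSet (sweepCore p q δ) := by
  refine (measurableSet_Ioo (a := p) (b := q)).inter (MeasurableSet.inter ?_ ?_)
  · exact measurableSet_le measurable_const
      (by fun_prop : Measurable fun t : ℝ≥0 => ((t : ℝ) - p) / ((q : ℝ) - p))
  · exact measurableSet_le
      (by fun_prop : Measurable fun t : ℝ≥0 => ((t : ℝ) - p) / ((q : ℝ) - p)) measurable_const

/-- The cores with `δ = 1 / (n + 1)` exhaust `(p, q)`. -/
lemma exists_measure_sweepCore_ne_zero (ν : Measure ℝ≥0) {p q : ℝ≥0}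
    (hν : ν (Set.Ioo p q) ≠ 0) : ∃ δ : ℝ, 0 < δ ∧ δ ≤ 1 ∧ ν (sweepCore p q δ) ≠ 0 := by
  by_contra! hcon
  refine hν (measure_mono_null (t := ⋃ n : ℕ, sweepCore p q (1 / ((n : ℝ) + 1))) ?_ ?_)
  · intro t ht
    have h1 : (p : ℝ) < t := ht.1
    have h2 : (t : ℝ) < q := ht.2
    set τ := ((t : ℝ) - p) / ((q : ℝ) - p) with hτ
    have hτ0 : 0 < τ := div_pos (by linarith) (by linarith)
    have hτ1 : τ < 1 := by rw [hτ, div_lt_one (by linarith)]; linarith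
    obtain ⟨n, hn⟩ := exists_nat_one_div_lt (lt_min hτ0 (sub_pos.2 hτ1))
    have h3 := hn.trans_le (min_le_left _ _)
    have h4 := hn.trans_le (min_le_right _ _)
    exact Set.mem_iUnion.2 ⟨n, ht, h3.le, by linarith⟩
  · refine measure_iUnion_null fun n => hcon _ (by positivity) ?_
    rw [div_le_one (by positivity)]
    linarith [(Nat.cast_nonneg n : (0 : ℝ) ≤ n)]

lemma sweep_of_lt {p q t : ℝ≥0} {δ u : ℝ} (ht : t ∈ sweepCore p q δ) (hu : u < δ) :
    sweep p q t u = q := by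
  simp [sweep, ht.1, hu.trans_le ht.2.1]

lemma sweep_of_ge {p q t : ℝ≥0} {δ u : ℝ} (ht : t ∈ sweepCore p q δ) (hu : 1 - δ ≤ u) :
    sweep p q t u = p := by
  simp [sweep, ht.1, ht.2.2.trans hu]

variable {E : Type*} [DecidableEq E] (ν : Measure ℝ≥0) [IsProbabilityMeasure ν]

/-- Separates the original weights `z` from the auxiliary randomness `u`, so that one can condition
on `z`. -/
lemma lmarginal_sweepMeasure (p q : ℝ≥0) {T : (E → ℝ≥0) → ℝ≥0∞} (hT : Measurable T) (R : Finset E)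
    (x : E → ℝ≥0) :
    (∫⋯∫⁻_R, T ∂fun _ => sweepMeasure ν p q) x =
      ∫⁻ z : R → ℝ≥0, ∫⁻ u : R → ℝ,
        T (Function.updateFinset x R fun e => sweep p q (z e) (u e))
          ∂(Measure.pi fun _ => unif) ∂(Measure.pi fun _ => ν) := by
  have hu : Measurable fun y : R → ℝ≥0 => T (Function.updateFinset x R y) :=
    hT.comp measurable_updateFinset
  have hs := measurable_sweep p q
  have h1 : Measure.pi (fun _ : R => sweepMeasure ν p q) =
      (Measure.pi fun _ : R => ν.prod unif).map fun z e => sweep p q (z e).1 (z e).2 := by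
    rw [Measure.pi_map_pi (fun _ => hs.aemeasurable)]; rfl
  have hs' : Measurable fun (z : R → ℝ≥0 × ℝ) (e : R) => sweep p q (z e).1 (z e).2 := by
    fun_prop
  have hmp := measurePreserving_arrowProdEquivProdArrow ℝ≥0 ℝ R (fun _ => ν) (fun _ => unif)
  rw [lmarginal, h1, lintegral_map hu hs']
  have hF : Measurable fun y : (R → ℝ≥0) × (R → ℝ) =>
      T (Function.updateFinset x R fun e => sweep p q (y.1 e) (y.2 e)) :=
    hu.comp (by fun_prop)
  rw [← lintegral_prod _ hF.aemeasurable, ← hmp.lintegral_comp hF]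
  rfl

lemma lintegral_sum_sweep (p q : ℝ≥0) (R S : Finset E) (x : E → ℝ≥0) (z : R → ℝ≥0) :
    ∫⁻ u : R → ℝ, ∑ e ∈ S, (Function.updateFinset x R (fun e => sweep p q (z e) (u e)) e : ℝ≥0∞)
      ∂(Measure.pi fun _ => unif) = ∑ e ∈ S, (Function.updateFinset x R z e : ℝ≥0∞) := by
  have hm : ∀ t, Measurable fun v => (sweep p q t v : ℝ≥0∞) := fun t =>
    ((measurable_sweep p q).comp (measurable_const.prodMk measurable_id)).coe_nnreal_ennreal
  rw [lintegral_finsetSum]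
  · refine Finset.sum_congr rfl fun e _ => ?_
    by_cases he : e ∈ R
    · simp only [Function.updateFinset, he, dif_pos]
      exact ((measurePreserving_eval (fun _ : R => unif) ⟨e, he⟩).lintegral_comp (hm _)).trans
        (lintegral_sweep p q _)
    · simp [Function.updateFinset, he]
  · intro e _
    by_cases he : e ∈ R
    · simp only [Function.updateFinset, he, dif_pos]
      exact (hm _).comp (measurable_pi_apply (⟨e, he⟩ : R))
    · simp [Function.updateFinset, he]

/-- If all the weights in a region are in the core of `(p, q)`, sweeping them lowers the minimal
cost on average. -/
lemma lintegral_minCost_sweep_add_le {p q : ℝ≥0} {ε δ : ℝ}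
    (hδ1 : δ ≤ 1) (hpq : p < q) (hε : (1 + ε) * p ≤ ((p : ℝ) + q) / 2)
    {𝒮 : Set (Finset E)} {R : Finset E} (hR : HasDetoursWithin ε 𝒮 R) (x : E → ℝ≥0)
    (z : R → ℝ≥0) (hz : ∀ e, z e ∈ sweepCore p q δ) :
    ∫⁻ u : R → ℝ, minCost 𝒮 (Function.updateFinset x R fun e => sweep p q (z e) (u e))
        ∂(Measure.pi fun _ => unif) + ENNReal.ofReal (((q : ℝ) - p) / 2) * ENNReal.ofReal δ ^ R.card
      ≤ minCost 𝒮 (Function.updateFinset x R z) := by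
  refine le_iInf₂ fun S hS => ?_
  obtain ⟨a, b, haS, haR, hbR, hab, hane, hcard, S', hS', hle⟩ := hR S hS
  set W : (R → ℝ) → E → ℝ≥0 := fun u =>
    Function.updateFinset x R fun e => sweep p q (z e) (u e) with hW
  -- The event that `a` is swept to `q` and every other edge of `R`, in particular `b`, to `p`. Each
  -- coordinate constraint has probability exactly `δ`.
  set I : R → Set ℝ := fun e => if (e : E) ∈ a then Set.Iio δ else Set.Ici (1 - δ) with hI
  set c : ℝ≥0∞ := ENNReal.ofReal (((q : ℝ) - p) / 2) with hc
  have hpi : (Measure.pi fun _ : R => unif) (Set.univ.pi I) = ENNReal.ofReal δ ^ R.card := by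
    rw [Measure.pi_pi]
    have : ∀ e, unif (I e) = ENNReal.ofReal δ := fun e => by
      simp only [hI]; split_ifs
      · exact unif_Iio hδ1
      · rw [unif_Ici (by linarith)]; simp
    simp [this]
  have hIm : MeasurableSet (Set.univ.pi I) := MeasurableSet.univ_pi fun e => by
    simp only [hI]; split_ifs
    · exact measurableSet_Iio
    · exact measurableSet_Ici
  -- By the choice of `ε` the exchange saves at least `|a| (q - p) / 2`, and `|a| ≥ 1`.
  have hpc : b.card * (p : ℝ≥0∞) + c ≤ a.card * (q : ℝ≥0∞) := by
    have h1 : (1 : ℝ) ≤ a.card := by exact_mod_cast hane.card_pos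
    have hpq' : (p : ℝ) < q := hpq
    have h2 : (b.card : ℝ) * p + ((q : ℝ) - p) / 2 ≤ a.card * q := by
      have := mul_le_mul_of_nonneg_right hcard p.coe_nonneg
      nlinarith
    rw [hc, ← ENNReal.ofReal_coe_nnreal (p := p), ← ENNReal.ofReal_coe_nnreal (p := q),
      ← ENNReal.ofReal_natCast, ← ENNReal.ofReal_natCast, ← ENNReal.ofReal_mul (by positivity),
      ← ENNReal.ofReal_mul (by positivity), ← ENNReal.ofReal_add (by positivity) (by linarith)]
    exact ENNReal.ofReal_le_ofReal h2
  have key : ∀ u, minCost 𝒮 (W u) + (Set.univ.pi I).indicator (fun _ => c) u ≤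
      ∑ e ∈ S, (W u e : ℝ≥0∞) := by
    intro u
    by_cases hu : u ∈ Set.univ.pi I
    · rw [Set.indicator_of_mem hu]
      have hWa : ∑ e ∈ a, (W u e : ℝ≥0∞) = a.card * (q : ℝ≥0∞) := by
        rw [← nsmul_eq_mul, ← Finset.sum_const]
        refine Finset.sum_congr rfl fun e he => ?_
        have := hu ⟨e, haR he⟩ (Set.mem_univ _)
        simp only [hI, he, if_true, Set.mem_Iio] at this
        simp [hW, Function.updateFinset, haR he, sweep_of_lt (hz ⟨e, haR he⟩) this]
      have hWb : ∑ e ∈ b, (W u e : ℝ≥0∞) = b.card * (p : ℝ≥0∞) := by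
        rw [← nsmul_eq_mul, ← Finset.sum_const]
        refine Finset.sum_congr rfl fun e he => ?_
        have := hu ⟨e, hbR he⟩ (Set.mem_univ _)
        simp only [hI, Finset.disjoint_right.1 hab he, if_false, Set.mem_Ici] at this
        simp [hW, Function.updateFinset, hbR he, sweep_of_ge (hz ⟨e, hbR he⟩) this]
      have h1 := hle (W u)
      rw [hWa, hWb] at h1
      have hfin : (b.card * (p : ℝ≥0∞)) ≠ ⊤ := ENNReal.mul_ne_top (by simp) (by simp)
      refine (ENNReal.add_le_add_iff_right hfin).1 ?_
      calc minCost 𝒮 (W u) + c + b.card * (p : ℝ≥0∞)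
          = minCost 𝒮 (W u) + (b.card * (p : ℝ≥0∞) + c) := by ring
        _ ≤ ∑ e ∈ S', (W u e : ℝ≥0∞) + a.card * (q : ℝ≥0∞) := by
            gcongr; exact minCost_le hS' _
        _ ≤ _ := h1
    · rw [Set.indicator_of_notMem hu, add_zero]; exact minCost_le hS _
  -- Averaged over `u`, the cost of the fixed set `S` is its cost before sweeping, so the pointwise
  -- saving can be integrated.
  rw [← lintegral_sum_sweep p q R S x z, ← hpi, ← lintegral_indicator_const hIm, ← lintegral_add_right _
    (measurable_const.indicator hIm)]
  exact lintegral_mono key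

variable {ν}

/-- The saving occurs when all weights in `R` lie in the core. For any other `z`, the mean cost of
each fixed set is preserved, so the mean of the minimum does not increase. -/
lemma HasGain.sweep [Countable E] {p q : ℝ≥0} {ε δ : ℝ} (hδ1 : δ ≤ 1) (hpq : p < q)
    (hε : (1 + ε) * p ≤ ((p : ℝ) + q) / 2) {𝒮 : Set (Finset E)} {R : Finset E}
    (hR : HasDetoursWithin ε 𝒮 R) :
    HasGain (minCost 𝒮) (sweepMeasure ν p q) ν R
      (ENNReal.ofReal (((q : ℝ) - p) / 2) * (ENNReal.ofReal δ * ν (sweepCore p q δ)) ^ R.card) := by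
  intro x
  have hm : MeasurableSet (Set.univ.pi fun _ : R => sweepCore p q δ) :=
    MeasurableSet.univ_pi fun _ => measurableSet_sweepCore p q δ
  have hpi : (Measure.pi fun _ : R => ν) (Set.univ.pi fun _ : R => sweepCore p q δ) =
      ν (sweepCore p q δ) ^ R.card := by
    rw [Measure.pi_pi]; simp
  rw [lmarginal_sweepMeasure ν p q (measurable_minCost 𝒮), mul_pow, ← mul_assoc, ← hpi,
    ← lintegral_indicator_const hm, ← lintegral_add_right _ (measurable_const.indicator hm)]
  refine lintegral_mono fun z => ?_
  by_cases hz : z ∈ Set.univ.pi fun _ : R => sweepCore p q δ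
  · simp only [Set.indicator_of_mem hz]
    exact lintegral_minCost_sweep_add_le hδ1 hpq hε hR x z fun e => hz e (Set.mem_univ _)
  · simp only [Set.indicator_of_notMem hz, add_zero]
    refine le_iInf₂ fun S hS => ?_
    exact (lintegral_mono fun u => minCost_le hS _).trans (lintegral_sum_sweep p q R S x z).le

lemma lmarginal_map {f : ℝ≥0 → ℝ≥0} (hf : Measurable f) {T : (E → ℝ≥0) → ℝ≥0∞}
    (hT : Measurable T) (R : Finset E) (x : E → ℝ≥0) :
    (∫⋯∫⁻_R, T ∂fun _ => ν.map f) x =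
      ∫⁻ z : R → ℝ≥0, T (Function.updateFinset x R fun e => f (z e)) ∂(Measure.pi fun _ => ν) := by
  have : IsProbabilityMeasure (ν.map f) := Measure.isProbabilityMeasure_map hf.aemeasurable
  have h1 : Measure.pi (fun _ : R => ν.map f) =
      (Measure.pi fun _ : R => ν).map fun z e => f (z e) := by
    rw [Measure.pi_map_pi (fun _ => hf.aemeasurable)]
  have hu : Measurable fun y : R → ℝ≥0 => T (Function.updateFinset x R y) :=
    hT.comp measurable_updateFinset
  rw [lmarginal, h1, lintegral_map hu (by fun_prop)]

/-- Every member of the family has an edge in `R`; if all weights there are at least `r`, truncating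
that one edge already saves `r - p`. -/
lemma HasGain.truncation [Countable E] {p r : ℝ≥0} {ε : ℝ}
    {𝒮 : Set (Finset E)} {R : Finset E} (hR : HasDetoursWithin ε 𝒮 R) :
    HasGain (minCost 𝒮) (ν.map (min p)) ν R
      (((r - p : ℝ≥0) : ℝ≥0∞) * ν (Set.Ici r) ^ R.card) := by
  intro x
  have hm : MeasurableSet (Set.univ.pi fun _ : R => Set.Ici r) :=
    MeasurableSet.univ_pi fun _ => measurableSet_Ici
  have hpi : (Measure.pi fun _ : R => ν) (Set.univ.pi fun _ : R => Set.Ici r) =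
      ν (Set.Ici r) ^ R.card := by
    rw [Measure.pi_pi]; simp
  have hmin : Measurable (min p : ℝ≥0 → ℝ≥0) := measurable_const.min measurable_id
  rw [lmarginal_map hmin (measurable_minCost 𝒮), ← hpi,
    ← lintegral_indicator_const hm, ← lintegral_add_right _ (measurable_const.indicator hm)]
  refine lintegral_mono fun z => le_iInf₂ fun S hS => ?_
  refine (add_le_add_left (minCost_le hS _) _).trans ?_
  have hle : ∀ e, (Function.updateFinset x R (fun e => min p (z e)) e : ℝ≥0∞) ≤
      Function.updateFinset x R z e := fun e => by
    by_cases he : e ∈ R <;> simp [Function.updateFinset, he]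
  by_cases hz : z ∈ Set.univ.pi fun _ : R => Set.Ici r
  · rw [Set.indicator_of_mem hz]
    obtain ⟨a, b, haS, haR, -, -, ⟨e, he⟩, -⟩ := hR S hS
    rw [← Finset.sum_erase_add _ _ (haS he), ← Finset.sum_erase_add S _ (haS he), add_assoc]
    refine add_le_add (Finset.sum_le_sum fun i _ => hle i) ?_
    have h1 : r ≤ z ⟨e, haR he⟩ := hz ⟨e, haR he⟩ (Set.mem_univ _)
    simp only [Function.updateFinset, haR he, dif_pos]
    norm_cast
    rcases le_total r p with h | h
    · rw [tsub_eq_zero_of_le h, add_zero]; exact min_le_right _ _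
    · rw [min_eq_left (h.trans h1), add_tsub_cancel_of_le h]; exact h1
  · rw [Set.indicator_of_notMem hz, add_zero]
    exact Finset.sum_le_sum fun i _ => hle i

lemma exists_lt_measure_Ici_ne_zero {ν : Measure ℝ≥0} {p : ℝ≥0} (h : ν (Set.Ioi p) ≠ 0) :
    ∃ r, p < r ∧ ν (Set.Ici r) ≠ 0 := by
  by_contra! hcon
  refine h (measure_mono_null (t := ⋃ n : ℕ, Set.Ici (p + 1 / ((n : ℝ≥0) + 1))) ?_ ?_)
  · intro t ht
    obtain ⟨n, hn⟩ := exists_nat_one_div_lt (K := ℝ) (sub_pos.2 (show (p : ℝ) < t from ht))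
    refine Set.mem_iUnion.2 ⟨n, ?_⟩
    rw [Set.mem_Ici, ← NNReal.coe_le_coe]
    push_cast
    linarith
  · exact measure_iUnion_null fun n => hcon _ (lt_add_of_pos_right p (by positivity))

/-- A uniform gain from every region of bounded size that contains detours for a suitable `ε`. -/
theorem StrictlyMoreVariable.exists_hasGain [Countable E] {ν' : Measure ℝ≥0}
    [IsProbabilityMeasure ν'] (hν : HasFiniteMean ν) (h : StrictlyMoreVariable ν' ν) :
    ∃ ε : ℝ, 0 < ε ∧ ∀ M : ℕ, ∃ c : ℝ≥0, 0 < c ∧ ∀ (𝒮 : Set (Finset E)) (R : Finset E),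
      R.card ≤ M → HasDetoursWithin ε 𝒮 R → HasGain (minCost 𝒮) ν' ν R c := by
  -- As `b ≤ 1`, the value at the largest exponent `M` is the smallest one, which makes the gain
  -- uniform over regions of size at most `M`.
  have pos : ∀ a b : ℝ≥0∞, a ≠ 0 → b ≠ 0 → b ≤ 1 → ∀ M : ℕ,
      ∃ c : ℝ≥0, 0 < c ∧ ∀ n ≤ M, (c : ℝ≥0∞) ≤ a * b ^ n := by
    intro a b ha hb hb1 M
    obtain ⟨c, hc0, hc⟩ := ENNReal.lt_iff_exists_nnreal_btwn.1
      (pos_iff_ne_zero.2 (mul_ne_zero ha (pow_ne_zero M hb)))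
    exact ⟨c, by exact_mod_cast hc0, fun n hn => hc.le.trans (by
      gcongr 1; exact pow_le_pow_right_of_le_one' hb1 hn)⟩
  rcases h.exists_sweep_or_truncation hν with ⟨p, q, hpq, hpos, hdom⟩ | ⟨p, hpos, hdom⟩
  · have hpq' : (p : ℝ) < q := hpq
    obtain ⟨δ, hδ0, hδ1, hδ⟩ := exists_measure_sweepCore_ne_zero ν hpos
    have hp0 := p.coe_nonneg
    -- This `ε` ensures `(1 + ε) p ≤ (p + q) / 2`; the `+ 1` covers `p = 0`.
    refine ⟨((q : ℝ) - p) / (2 * (p + 1)), div_pos (by linarith) (by positivity), fun M => ?_⟩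
    have hε : (1 + ((q : ℝ) - p) / (2 * (p + 1))) * p ≤ ((p : ℝ) + q) / 2 := by
      have h1 : ((q : ℝ) - p) / (2 * (p + 1)) * p ≤ ((q : ℝ) - p) / 2 := by
        rw [div_mul_eq_mul_div, div_le_div_iff₀ (by positivity) (by norm_num)]
        nlinarith
      linarith
    obtain ⟨c, hc, hcM⟩ := pos (ENNReal.ofReal (((q : ℝ) - p) / 2))
      (ENNReal.ofReal δ * ν (sweepCore p q δ))
      (by simp only [ne_eq, ENNReal.ofReal_eq_zero, not_le]; linarith)
      (mul_ne_zero (by simpa using hδ0) hδ)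
      (mul_le_one' (by simpa using hδ1) prob_le_one) M
    refine ⟨c, hc, fun 𝒮 R hRM hR => ?_⟩
    have := (HasGain.of_minDominated hdom 𝒮 R).trans (HasGain.sweep hδ1 hpq hε hR)
    exact this.mono (by rw [zero_add]; exact hcM _ hRM)
  -- Truncation gains whatever the size of the detour, so any `ε` would do.
  · refine ⟨1, one_pos, fun M => ?_⟩
    obtain ⟨r, hpr, hr⟩ := exists_lt_measure_Ici_ne_zero hpos
    obtain ⟨c, hc, hcM⟩ := pos ((r - p : ℝ≥0) : ℝ≥0∞) (ν (Set.Ici r))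
      (by exact_mod_cast (tsub_pos_of_lt hpr).ne') hr prob_le_one M
    have : IsProbabilityMeasure (ν.map (min p)) :=
      Measure.isProbabilityMeasure_map (measurable_const.min measurable_id).aemeasurable
    refine ⟨c, hc, fun 𝒮 R hRM hR => ?_⟩
    have := (HasGain.of_minDominated hdom 𝒮 R).trans (HasGain.truncation (r := r) hR)
    exact this.mono (by rw [zero_add]; exact hcM _ hRM)

end RegionGain

section Graphs

variable {α : Type u} {β : Type v} {G : Graph α β}

namespace Path

/-! ### Operations on paths -/

/-- Concatenation of paths. -/
def append : {x y z : V(G)} → Path G x y → Path G y z → Path G x z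
  | _, _, _, nil _, q => q
  | _, _, _, cons e h p, q => cons e h (p.append q)

@[simp]
lemma edges_append {x y z : V(G)} (p : Path G x y) (q : Path G y z) :
    (p.append q).edges = p.edges ++ q.edges := by
  induction p with
  | nil => rfl
  | cons e h p ih => simp [append, edges, ih]

@[simp]
lemma length_append {x y z : V(G)} (p : Path G x y) (q : Path G y z) :
    (p.append q).length = p.length + q.length := by simp [length]

@[simp]
lemma length_nil (x : V(G)) : (nil x : Path G x x).length = 0 := rfl

@[simp]
lemma length_cons {x y z : V(G)} (e : E(G)) (h : G.IsLink e x y) (p : Path G y z) :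
    (cons e h p).length = p.length + 1 := rfl

lemma exists_reverse {x y : V(G)} (p : Path G x y) : ∃ q : Path G y x, q.length = p.length := by
  induction p with
  | nil x => exact ⟨nil x, rfl⟩
  | cons e h p ih =>
    obtain ⟨q, hq⟩ := ih
    exact ⟨q.append (cons e h.symm (nil _)), by simp [hq]⟩

lemma start_mem_vertices {x y : V(G)} (p : Path G x y) : x ∈ p.vertices := by
  cases p <;> simp [vertices]

lemma mem_vertices_of_inc {x y : V(G)} (p : Path G x y) {e : E(G)} (he : e ∈ p.edges) {a : V(G)}
    (ha : G.Inc e a) : a ∈ p.vertices := by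
  induction p with
  | nil => simp [edges] at he
  | cons e' h p ih =>
    rcases List.mem_cons.1 he with rfl | he
    · rcases ha.eq_or_eq_of_isLink h with h' | h'
      · rw [Subtype.ext h']; simp [vertices]
      · rw [Subtype.ext h']; simp [vertices, start_mem_vertices]
    · simp [vertices, ih he]

lemma IsSelfAvoiding.edges_nodup {x y : V(G)} {p : Path G x y} (hp : p.IsSelfAvoiding) :
    p.edges.Nodup := by
  induction p with
  | nil => simp [edges]
  | cons e h p ih =>
    obtain ⟨h1, h2⟩ := List.nodup_cons.1 hp
    exact List.nodup_cons.2 ⟨fun he => h1 (p.mem_vertices_of_inc he h.inc_left), ih h2⟩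

lemma exists_split_of_mem_vertices {x y z : V(G)} (p : Path G x y) (hz : z ∈ p.vertices) :
    ∃ (p₁ : Path G x z) (p₂ : Path G z y), p.edges = p₁.edges ++ p₂.edges ∧
      p₂.vertices <:+ p.vertices := by
  induction p with
  | nil x =>
    obtain rfl : z = x := by simpa [vertices] using hz
    exact ⟨nil z, nil z, rfl, List.suffix_rfl⟩
  | @cons x y' y e h p ih =>
    rcases List.mem_cons.1 hz with rfl | hz
    · exact ⟨nil _, cons e h p, rfl, List.suffix_rfl⟩
    · obtain ⟨p₁, p₂, h1, h2⟩ := ih hz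
      exact ⟨cons e h p₁, p₂, by simp [edges, h1], h2.trans (List.suffix_cons _ _)⟩

lemma exists_split_of_le_length {x y : V(G)} (p : Path G x y) {n : ℕ} (hn : n ≤ p.length) :
    ∃ (z : V(G)) (p₁ : Path G x z) (p₂ : Path G z y), p.edges = p₁.edges ++ p₂.edges ∧
      p₁.length = n ∧ p₁.vertices <+: p.vertices := by
  induction p generalizing n with
  | nil x =>
    obtain rfl : n = 0 := by simpa using hn
    exact ⟨x, nil x, nil x, rfl, rfl, List.prefix_rfl⟩
  | @cons x y' y e h p ih =>
    cases n with
    | zero => exact ⟨x, nil x, cons e h p, rfl, rfl, by simp [vertices]⟩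
    | succ n =>
      obtain ⟨z, p₁, p₂, h1, h2, h3⟩ := ih (n := n) (by simpa using hn)
      exact ⟨z, cons e h p₁, p₂, by simp [edges, h1], by simp [h2],
        by simpa [vertices] using h3⟩

/-- Loop erasure. -/
lemma exists_isSelfAvoiding {x y : V(G)} (p : Path G x y) :
    ∃ q : Path G x y, q.IsSelfAvoiding ∧ q.edges.Sublist p.edges := by
  induction p with
  | nil x => exact ⟨nil x, by simp [IsSelfAvoiding, vertices], List.Sublist.refl _⟩
  | @cons x y' y e h p ih =>
    obtain ⟨q, hq, hqp⟩ := ih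
    by_cases hx : x ∈ q.vertices
    · obtain ⟨q₁, q₂, h1, h2⟩ := q.exists_split_of_mem_vertices hx
      refine ⟨q₂, hq.sublist h2.sublist, ?_⟩
      have : q₂.edges.Sublist q.edges := by rw [h1]; exact List.sublist_append_right _ _
      exact (this.trans hqp).trans (List.sublist_cons_self _ _)
    · exact ⟨cons e h q, List.nodup_cons.2 ⟨hx, hq⟩, hqp.cons_cons e⟩

/-- Take the first step that leaves `P`. -/
lemma exists_crossing {x y : V(G)} (p : Path G x y) (P : V(G) → Prop) (hx : P x) (hy : ¬ P y) :
    ∃ (z z' : V(G)) (e : E(G)), G.IsLink e z z' ∧ P z ∧ ¬ P z' ∧ z ∈ p.vertices := by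
  induction p with
  | nil x => exact absurd hx hy
  | @cons x y' y e h p ih =>
    by_cases hy' : P y'
    · obtain ⟨z, z', e', h1, h2, h3, h4⟩ := ih hy' hy
      exact ⟨z, z', e', h1, h2, h3, List.mem_cons_of_mem _ h4⟩
    · exact ⟨x, y', e, h, hx, hy', start_mem_vertices _⟩

lemma passageTime_le_of_sublist {x y x' y' : V(G)} {p : Path G x y} {q : Path G x' y'}
    (h : q.edges.Sublist p.edges) (w : E(G) → ℝ≥0) : q.passageTime w ≤ p.passageTime w :=
  (h.map w).sum_le_sum fun _ _ => zero_le

end Path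

/-! ### The graph distance -/

lemma gdist_le {x y : V(G)} (p : Path G x y) : gdist G x y ≤ p.length :=
  ciInf_le (OrderBot.bddBelow _) p

lemma IsConnected.exists_length_eq (h : IsConnected G) (x y : V(G)) :
    ∃ p : Path G x y, p.length = gdist G x y :=
  have := h x y
  Nat.sInf_mem (Set.range_nonempty fun p : Path G x y => p.length)

lemma IsConnected.gdist_comm (h : IsConnected G) (x y : V(G)) : gdist G x y = gdist G y x := by
  have : ∀ x y, gdist G x y ≤ gdist G y x := fun x y => by
    obtain ⟨p, hp⟩ := h.exists_length_eq y x
    obtain ⟨q, hq⟩ := p.exists_reverse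
    exact (gdist_le q).trans (by rw [hq, hp])
  exact le_antisymm (this x y) (this y x)

lemma IsConnected.gdist_triangle (h : IsConnected G) (x y z : V(G)) :
    gdist G x z ≤ gdist G x y + gdist G y z := by
  obtain ⟨p, hp⟩ := h.exists_length_eq x y
  obtain ⟨q, hq⟩ := h.exists_length_eq y z
  rw [← hp, ← hq, ← Path.length_append]
  exact gdist_le _

lemma gdist_le_one {x y : V(G)} {e : E(G)} (h : G.IsLink e x y) : gdist G x y ≤ 1 :=
  gdist_le (Path.cons e h (Path.nil y))

/-! ### Counting paths -/

/-- The current vertex and the next edge determine the next vertex, so there are at most `D`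
continuations at each step. -/
lemma exists_finset_edges (D : ℕ) (hD : ∀ x : V(G), (G.incidenceSet x).encard ≤ D) (r : ℕ)
    (x : V(G)) : ∃ L : Finset (List E(G)), L.card ≤ D ^ r ∧
      ∀ (y : V(G)) (p : Path G x y), p.length = r → p.edges ∈ L := by
  classical
  induction r generalizing x with
  | zero =>
    refine ⟨{[]}, by simp, fun y p hp => ?_⟩
    simpa using List.eq_nil_of_length_eq_zero hp
  | succ r ih =>
    choose L hL hLp using ih
    have hinc : {e : E(G) | G.Inc e x}.encard ≤ D := by
      refine le_trans ?_ (hD x)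
      rw [← Subtype.val_injective.encard_image]
      refine Set.encard_le_encard ?_
      rintro _ ⟨e, he, rfl⟩
      exact he
    have hfin : {e : E(G) | G.Inc e x}.Finite := Set.finite_of_encard_le_coe hinc
    -- The other end of `e`; the value `x` is a dummy for edges not incident to `x`.
    have hex : ∀ e : E(G), ∃ y : V(G), ∀ y' : V(G), G.IsLink e x y' → y' = y := fun e => by
      by_cases he : ∃ y : V(G), G.IsLink e x y
      · obtain ⟨y, hy⟩ := he
        exact ⟨y, fun y' hy' => Subtype.ext (hy'.right_unique hy)⟩
      · exact ⟨x, fun y' hy' => absurd ⟨y', hy'⟩ he⟩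
    choose o ho using hex
    refine ⟨hfin.toFinset.biUnion fun e => (L (o e)).image (List.cons e), ?_, ?_⟩
    · rw [pow_succ']
      refine (Finset.card_biUnion_le_card_mul _ _ (D ^ r) fun e _ =>
        Finset.card_image_le.trans (hL _)).trans ?_
      gcongr
      rw [← Nat.cast_le (α := ℕ∞), ← Set.encard_coe_eq_coe_finsetCard, Set.Finite.coe_toFinset]
      exact hinc
    · intro y p hp
      cases p with
      | nil => simp at hp
      | @cons _ y' _ e h p =>
        refine Finset.mem_biUnion.2 ⟨e, by simpa using h.inc_left,
          Finset.mem_image.2 ⟨p.edges, ?_, rfl⟩⟩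
        rw [← ho e y' h]
        exact hLp _ _ p (by simpa using hp)

/-- The edges lying on a path of length at most `r` started at `x`. -/
def edgeBall (G : Graph α β) (x : V(G)) (r : ℕ) : Set E(G) :=
  {e | ∃ (y : V(G)) (p : Path G x y), p.length ≤ r ∧ e ∈ p.edges}

lemma HasBoundedDegree.exists_edgeBall_eq (h : HasBoundedDegree G) (r : ℕ) :
    ∃ M : ℕ, ∀ x : V(G), ∃ R : Finset E(G), R.card ≤ M ∧ (R : Set E(G)) = edgeBall G x r := by
  classical
  obtain ⟨D, hD⟩ := h
  choose L hL hLp using exists_finset_edges D hD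
  refine ⟨∑ k ∈ Finset.range (r + 1), D ^ k * k, fun x => ?_⟩
  set B : Finset E(G) := (Finset.range (r + 1)).biUnion fun k =>
    ((L k x).filter fun l => l.length = k).biUnion List.toFinset with hB
  have hsub : edgeBall G x r ⊆ B := by
    rintro e ⟨y, p, hp, he⟩
    simp only [hB, Finset.coe_biUnion, Set.mem_iUnion, Finset.mem_coe, Finset.mem_range,
      Finset.mem_filter]
    exact ⟨p.length, by omega, p.edges, ⟨hLp _ _ _ p rfl, rfl⟩, by simpa using he⟩
  have hfin : (edgeBall G x r).Finite := B.finite_toSet.subset hsub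
  refine ⟨hfin.toFinset, ?_, by simp⟩
  refine (Finset.card_le_card (t := B) fun e he => hsub (by simpa using he)).trans ?_
  refine Finset.card_biUnion_le.trans (Finset.sum_le_sum fun k _ => ?_)
  refine (Finset.card_biUnion_le_card_mul _ _ k fun l hl => ?_).trans
    (Nat.mul_le_mul_right k ((Finset.card_filter_le _ _).trans (hL k x)))
  exact (List.toFinset_card_le l).trans (Finset.mem_filter.1 hl).2.le

lemma mem_edgeBall_of_isLink {x y z : V(G)} (p : Path G x y) {e : E(G)} (h : G.IsLink e y z) :
    e ∈ edgeBall G x (p.length + 1) :=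
  ⟨z, p.append (Path.cons e h (Path.nil z)), by simp, by simp [Path.edges]⟩

lemma countable_edgeSet (hconn : IsConnected G) (hdeg : HasBoundedDegree G) :
    Countable E(G) := by
  rcases isEmpty_or_nonempty E(G) with h | ⟨⟨e₀, he₀⟩⟩
  · infer_instance
  obtain ⟨x, y, hxy⟩ := G.exists_isLink_of_mem_edgeSet he₀
  have : (Set.univ : Set E(G)) ⊆ ⋃ r, edgeBall G ⟨x, hxy.left_mem⟩ r := by
    rintro ⟨e, he⟩ -
    obtain ⟨a, b, hab⟩ := G.exists_isLink_of_mem_edgeSet he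
    obtain ⟨p⟩ := hconn ⟨x, hxy.left_mem⟩ ⟨a, hab.left_mem⟩
    exact Set.mem_iUnion.2 ⟨_, mem_edgeBall_of_isLink (z := ⟨b, hab.right_mem⟩) p hab⟩
  refine Set.countable_univ_iff.1 (Set.Countable.mono this (Set.countable_iUnion fun r => ?_))
  obtain ⟨M, hM⟩ := hdeg.exists_edgeBall_eq r
  obtain ⟨R, -, hR⟩ := hM ⟨x, hxy.left_mem⟩
  rw [← hR]; exact R.countable_toSet

lemma gdist_le_of_mem_edgeBall {x a : V(G)} {r : ℕ} {e : E(G)} (he : e ∈ edgeBall G x r)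
    (ha : G.Inc e a) : gdist G x a ≤ r := by
  obtain ⟨y, p, hp, he⟩ := he
  obtain ⟨p₁, p₂, h1, -⟩ := p.exists_split_of_mem_vertices (p.mem_vertices_of_inc he ha)
  have : p.length = p₁.length + p₂.length := by simp [Path.length, h1]
  exact (gdist_le p₁).trans (by omega)

/-! ### Bottlenecks in quasi-trees -/

section Tree

variable {W : Type*} {S : SimpleGraph W}

/-- In a tree, a vertex on the geodesic from `a` to `b` separates `a` from `b`. -/
lemma mem_support_of_dist_add_dist_eq (hS : S.IsTree) {a b t : W}
    (h : S.dist a t + S.dist t b = S.dist a b) (w : S.Walk a b) : t ∈ w.support := by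
  classical
  obtain ⟨p, hp⟩ := hS.1.exists_walk_length_eq_dist a t
  obtain ⟨q, hq⟩ := hS.1.exists_walk_length_eq_dist t b
  have hpq : (p.append q).IsPath := (p.append q).isPath_of_length_eq_dist (by
    rw [SimpleGraph.Walk.length_append, hp, hq, h])
  have heq : w.bypass = p.append q :=
    congrArg Subtype.val
      ((hS.2.subsingleton_path a b).elim ⟨w.bypass, w.bypass_isPath⟩ ⟨_, hpq⟩)
  refine w.support_bypass_subset_support ?_
  rw [heq, SimpleGraph.Walk.mem_support_append_iff]
  exact Or.inl p.end_mem_support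

lemma exists_geodesic_points (hS : S.IsTree) (a b : W) :
    ∃ t : ℕ → W, ∀ k ≤ S.dist a b, S.dist a (t k) = k ∧ S.dist (t k) b = S.dist a b - k := by
  obtain ⟨p, hp⟩ := hS.1.exists_walk_length_eq_dist a b
  refine ⟨p.getVert, fun k hk => ?_⟩
  have h1 : S.dist a (p.getVert k) ≤ k := (SimpleGraph.dist_le (p.take k)).trans (by simp)
  have h2 : S.dist (p.getVert k) b ≤ S.dist a b - k :=
    (SimpleGraph.dist_le (p.drop k)).trans (by simp [hp])
  have h3 := hS.1.dist_triangle (u := a) (v := p.getVert k) (w := b)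
  omega

end Tree

section QuasiTree

variable {W : Type*} {S : SimpleGraph W}

/-- A path in `G` whose endpoints are mapped to different sides of `t` is mapped close to `t`
somewhere. -/
lemma exists_mem_vertices_dist_le (hS : S.IsTree) {f : V(G) → W} {L : ℝ}
    (hL : ∀ (z z' : V(G)) (e : E(G)), G.IsLink e z z' → (S.dist (f z) (f z') : ℝ) ≤ L)
    {x y : V(G)} {t : W} (ht : S.dist (f x) t + S.dist t (f y) = S.dist (f x) (f y))
    (hty : t ≠ f y) (p : Path G x y) : ∃ z ∈ p.vertices, (S.dist (f z) t : ℝ) ≤ L := by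
  classical
  -- Look at the first edge after which `t` no longer separates the image from `f y`. A tree
  -- geodesic between the images of its ends must contain `t`, and it has length at most `L`.
  obtain ⟨z, z', e, hlink, hz, hz', hmem⟩ := p.exists_crossing
    (fun z => ∀ w : S.Walk (f z) (f y), t ∈ w.support)
    (fun w => mem_support_of_dist_add_dist_eq hS ht w)
    (fun h => hty (by simpa using h SimpleGraph.Walk.nil))
  push Not at hz'
  obtain ⟨w, hw⟩ := hz'
  obtain ⟨r, hr⟩ := hS.1.exists_walk_length_eq_dist (f z) (f z')
  have htr : t ∈ r.support := by
    rcases (SimpleGraph.Walk.mem_support_append_iff r w).1 (hz (r.append w)) with h | h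
    · exact h
    · exact absurd h hw
  refine ⟨z, hmem, le_trans ?_ (hL z z' e hlink)⟩
  have : S.dist (f z) t ≤ S.dist (f z) (f z') := by
    rw [← hr]
    exact (SimpleGraph.dist_le (r.takeUntil t htr)).trans (r.length_takeUntil_le_length htr)
  exact_mod_cast this

/-- Between any two vertices of a quasi-tree there are linearly many bottlenecks, as far apart as
desired. -/
theorem exists_bottlenecks (hS : S.IsTree) (hqi : QuasiIsometricTo G S) :
    ∃ ρ : ℕ, ∀ Δ : ℕ, ∃ κ b : ℝ, 0 < κ ∧ ∀ x y : V(G), ∃ (n : ℕ) (v : ℕ → V(G)),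
      κ * gdist G x y - b ≤ n ∧ ∀ i < n,
        (∀ p : Path G x y, ∃ z ∈ p.vertices, gdist G (v i) z ≤ ρ) ∧ Δ ≤ gdist G (v i) y ∧
        ∀ j < n, i ≠ j → Δ ≤ gdist G (v i) (v j) := by
  obtain ⟨f, K, C, hK, hC, hf, hsurj⟩ := hqi
  have hK0 : 0 < K := by linarith
  have lower : ∀ x y : V(G), (gdist G x y : ℝ) ≤ K * (S.dist (f x) (f y) + C) := fun x y => by
    have := (hf x y).1
    rw [sub_le_iff_le_add, inv_mul_le_iff₀ hK0] at this
    exact this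
  -- Paths are mapped to within `K + C` of `t`, and the image of the chosen vertex is within `C` of
  -- `t`; applying `lower` costs another `C` and the factor `K`.
  refine ⟨⌈K * (K + 3 * C)⌉₊, fun Δ => ?_⟩
  -- The spacing in the tree: `2 * C` is lost in approximating two points by images, one more `C` in
  -- returning to `G`, and `+ 1` keeps `s` positive.
  set s : ℕ := ⌈K * Δ + 3 * C⌉₊ + 1 with hs
  have hsΔ : K * Δ + 3 * C ≤ s := by
    rw [hs]; push_cast
    linarith [Nat.le_ceil (K * Δ + 3 * C)]
  have hs0 : (0 : ℝ) < s := by rw [hs]; positivity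
  have far : ∀ x y : V(G), (s : ℝ) - 2 * C ≤ S.dist (f x) (f y) → Δ ≤ gdist G x y := by
    intro x y h
    have h1 := (hf x y).2
    have h2 : K * Δ ≤ K * gdist G x y := by linarith
    exact_mod_cast le_of_mul_le_mul_left h2 hK0
  refine ⟨1 / (K * s), C / s + 1, by positivity, fun x y => ?_⟩
  obtain ⟨t, ht⟩ := exists_geodesic_points hS (f x) (f y)
  set D := S.dist (f x) (f y) with hD
  choose g hg using hsurj
  -- With `i < D / s`, even the last point is at distance at least `s` from `f y`.
  refine ⟨D / s, fun i => g (t (s * i)), ?_, fun i hi => ?_⟩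
  · have h1 : (gdist G x y : ℝ) / K ≤ D + C := by
      rw [div_le_iff₀ hK0, mul_comm]; exact lower x y
    have h2 : (D : ℝ) / s ≤ (D / s : ℕ) + 1 := by
      rw [div_le_iff₀ hs0]
      have := Nat.lt_div_mul_add (a := D) (b := s) (by omega)
      have h3 : D ≤ (D / s + 1) * s := by rw [add_mul, one_mul]; exact this.le
      exact_mod_cast h3
    have h3 : 1 / (K * s) * gdist G x y = (gdist G x y : ℝ) / K / s := by field_simp
    have h4 : (gdist G x y : ℝ) / K / s ≤ (D + C) / s := by gcongr
    rw [h3]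
    rw [add_div] at h4
    linarith
  · have bound : ∀ i < D / s, s * i + s ≤ D := fun i hi => by
      calc s * i + s = (i + 1) * s := by ring
        _ ≤ D / s * s := Nat.mul_le_mul_right s hi
        _ ≤ D := Nat.div_mul_le_self D s
    have hti := ht (s * i) (by have := bound i hi; omega)
    have hty : s ≤ S.dist (t (s * i)) (f y) := by have := bound i hi; omega
    have tri : ∀ a b c : W, S.dist a c ≤ S.dist a b + S.dist b c := fun _ _ _ =>
      hS.1.dist_triangle
    refine ⟨fun p => ?_, ?_, fun j hj hij => ?_⟩
    · obtain ⟨z, hz, hzt⟩ := exists_mem_vertices_dist_le hS (L := K + C)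
        (fun z z' e he => by
          refine (hf z z').2.trans ?_
          have : (gdist G z z' : ℝ) ≤ 1 := by exact_mod_cast gdist_le_one he
          nlinarith)
        (t := t (s * i)) (by have := bound i hi; omega)
        (by
          intro h
          rw [h, SimpleGraph.dist_self] at hty
          omega) p
      refine ⟨z, hz, ?_⟩
      have h1 : (S.dist (f (g (t (s * i)))) (f z) : ℝ) ≤
          S.dist (f (g (t (s * i)))) (t (s * i)) + S.dist (t (s * i)) (f z) := by
        exact_mod_cast tri _ _ _
      rw [SimpleGraph.dist_comm (u := t (s * i))] at h1
      have h2 := lower (g (t (s * i))) z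
      have h3 := hg (t (s * i))
      have h4 : (gdist G (g (t (s * i))) z : ℝ) ≤ K * (K + 3 * C) :=
        h2.trans (mul_le_mul_of_nonneg_left (by linarith) hK0.le)
      exact_mod_cast h4.trans (Nat.le_ceil _)
    · refine far _ _ ?_
      have h1 : (S.dist (t (s * i)) (f y) : ℝ) ≤
          S.dist (t (s * i)) (f (g (t (s * i)))) + S.dist (f (g (t (s * i)))) (f y) := by
        exact_mod_cast tri _ _ _
      rw [SimpleGraph.dist_comm (u := t (s * i)) (v := f (g (t (s * i))))] at h1
      have h2 := hg (t (s * i))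
      have h3 : (s : ℝ) ≤ S.dist (t (s * i)) (f y) := by exact_mod_cast hty
      linarith
    · refine far _ _ ?_
      have htj := ht (s * j) (by have := bound j hj; omega)
      have h0 : s ≤ S.dist (t (s * i)) (t (s * j)) := by
        have t1 := tri (f x) (t (s * i)) (t (s * j))
        have t2 := tri (f x) (t (s * j)) (t (s * i))
        rw [SimpleGraph.dist_comm (u := t (s * j))] at t2
        rw [hti.1, htj.1] at t1 t2
        rcases lt_or_gt_of_ne hij with h | h
        · have : s * i + s ≤ s * j := by rw [← Nat.mul_succ]; exact Nat.mul_le_mul_left s h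
          omega
        · have : s * j + s ≤ s * i := by rw [← Nat.mul_succ]; exact Nat.mul_le_mul_left s h
          omega
      have h1 : (S.dist (t (s * i)) (t (s * j)) : ℝ) ≤
          S.dist (t (s * i)) (f (g (t (s * i)))) + (S.dist (f (g (t (s * i))))
            (f (g (t (s * j)))) + S.dist (f (g (t (s * j)))) (t (s * j))) := by
        exact_mod_cast (tri _ _ _).trans (Nat.add_le_add_left (tri _ _ _) _)
      rw [SimpleGraph.dist_comm (u := t (s * i)) (v := f (g (t (s * i))))] at h1
      have h2 := hg (t (s * i))
      have h3 := hg (t (s * j))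
      have h4 : (s : ℝ) ≤ S.dist (t (s * i)) (t (s * j)) := by exact_mod_cast h0
      linarith

end QuasiTree

/-! ### Detours inside regions -/

open Classical in
/-- The edge sets of the self-avoiding paths from `x` to `y` that only use edges in `F`. -/
def pathSetsWithin (G : Graph α β) (x y : V(G)) (F : Finset E(G)) : Set (Finset E(G)) :=
  {A | A ⊆ F ∧ ∃ p : Path G x y, p.IsSelfAvoiding ∧ p.edges.toFinset = A}

open Classical in
lemma Path.IsSelfAvoiding.sum_toFinset {x y : V(G)} {p : Path G x y} (hp : p.IsSelfAvoiding)
    (w : E(G) → ℝ≥0) : ∑ e ∈ p.edges.toFinset, (w e : ℝ≥0∞) = p.passageTime w := by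
  rw [← ENNReal.ofNNReal_finsetSum, List.sum_toFinset w hp.edges_nodup]; rfl

open Classical in
lemma Path.edgeSet_eq_coe_toFinset {x y : V(G)} (p : Path G x y) :
    p.edgeSet = (p.edges.toFinset : Set E(G)) := by
  ext e; simp [Path.edgeSet]

lemma Path.passageTime_of_edges_eq {x y x₁ y₁ x₂ y₂ x₃ y₃ : V(G)} {p : Path G x y}
    {p₁ : Path G x₁ y₁} {p₂ : Path G x₂ y₂} {p₃ : Path G x₃ y₃}
    (h : p.edges = p₁.edges ++ (p₂.edges ++ p₃.edges)) (w : E(G) → ℝ≥0) :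
    p.passageTime w = p₁.passageTime w + (p₂.passageTime w + p₃.passageTime w) := by
  simp [Path.passageTime, h]

/-- A self-avoiding path through a vertex near `v` which then goes far away has a long piece
started near `v`. -/
lemma exists_middle_piece (hconn : IsConnected G) {x y v z : V(G)} {ρ ℓ : ℕ} {p : Path G x y}
    (hp : p.IsSelfAvoiding) (hz : z ∈ p.vertices) (hvz : gdist G v z ≤ ρ)
    (hvy : ρ + ℓ ≤ gdist G v y) :
    ∃ (z' : V(G)) (p₁ : Path G x z) (p₂ : Path G z z') (p₃ : Path G z' y),
      p.edges = p₁.edges ++ (p₂.edges ++ p₃.edges) ∧ p₂.IsSelfAvoiding ∧ p₂.length = ℓ := by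
  obtain ⟨p₁, q, h1, hsuf⟩ := p.exists_split_of_mem_vertices hz
  have h2 := hconn.gdist_triangle v z y
  have h3 := gdist_le q
  obtain ⟨z', p₂, p₃, h4, h5, hpre⟩ := q.exists_split_of_le_length (n := ℓ) (by omega)
  exact ⟨z', p₁, p₂, p₃, by rw [h1, h4], hp.sublist (hpre.sublist.trans hsuf.sublist), h5⟩

open Classical in
-- If `p \ q` were empty, the inequality would empty `q \ p` as well and make the edge sets equal.
-- The last bound keeps the detour inside a ball of controlled radius.
lemma card_toFinset_le_of_isDetour {ε : ℝ} (hε : 0 ≤ ε) {x y : V(G)} {p q : Path G x y}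
    (hq : q.IsDetour ε p) :
    ((q.edges.toFinset \ p.edges.toFinset).card : ℝ) ≤
        (1 + ε) * (p.edges.toFinset \ q.edges.toFinset).card ∧
      (p.edges.toFinset \ q.edges.toFinset).Nonempty ∧
      (q.edges.toFinset.card : ℝ) ≤ p.length + (1 + ε) * p.length := by
  obtain ⟨hne, hle⟩ := hq
  rw [Path.edgeSet_eq_coe_toFinset, Path.edgeSet_eq_coe_toFinset] at hne hle
  rw [← Finset.coe_sdiff, ← Finset.coe_sdiff, Set.ncard_coe_finset, Set.ncard_coe_finset] at hle
  have hcard : (p.edges.toFinset.card : ℝ) ≤ p.length := by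
    exact_mod_cast List.toFinset_card_le p.edges
  refine ⟨hle, ?_, ?_⟩
  · by_contra hemp
    rw [Finset.not_nonempty_iff_eq_empty] at hemp
    rw [hemp] at hle
    have h0 : q.edges.toFinset \ p.edges.toFinset = ∅ := by
      rw [← Finset.card_eq_zero, ← Nat.le_zero]
      exact_mod_cast (by simpa using hle :
        ((q.edges.toFinset \ p.edges.toFinset).card : ℝ) ≤ (0 : ℕ))
    exact hne (congrArg _ (Finset.Subset.antisymm (Finset.sdiff_eq_empty_iff_subset.1 h0)
      (Finset.sdiff_eq_empty_iff_subset.1 hemp)))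
  · have h1 : q.edges.toFinset.card ≤
        p.edges.toFinset.card + (q.edges.toFinset \ p.edges.toFinset).card := by
      rw [← Finset.card_union_of_disjoint Finset.disjoint_sdiff]
      exact Finset.card_le_card (by simp)
    have h2 : ((p.edges.toFinset \ q.edges.toFinset).card : ℝ) ≤ p.length :=
      le_trans (by exact_mod_cast Finset.card_le_card Finset.sdiff_subset) hcard
    have h3 : (q.edges.toFinset.card : ℝ) ≤
        p.edges.toFinset.card + (q.edges.toFinset \ p.edges.toFinset).card := by exact_mod_cast h1
    have h4 := mul_le_mul_of_nonneg_left h2 (by linarith : 0 ≤ 1 + ε)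
    linarith

open Classical in
-- Near the bottleneck the path has a piece `p₂` of length `ℓ`, to be replaced by its detour `q`.
-- The radius `r` has room for reaching the piece and for either version of it.
lemma hasDetoursWithin_pathSetsWithin (hconn : IsConnected G) {ε : ℝ} (hε : 0 ≤ ε) {ℓ ρ r : ℕ}
    (hdet : ∀ (x y : V(G)) (p : Path G x y), p.IsSelfAvoiding → p.length = ℓ →
      ∃ q : Path G x y, q.IsSelfAvoiding ∧ q.IsDetour ε p)
    (hr : ρ + (ℓ + (1 + ε) * ℓ) ≤ r) {x y v : V(G)}
    (hv : ∀ p : Path G x y, ∃ z ∈ p.vertices, gdist G v z ≤ ρ) (hvy : ρ + ℓ ≤ gdist G v y)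
    {F R : Finset E(G)} (hR : (R : Set E(G)) = edgeBall G v r) (hRF : R ⊆ F) :
    HasDetoursWithin ε (pathSetsWithin G x y F) R := by
  rintro A ⟨hAF, p, hp, rfl⟩
  obtain ⟨z, hz, hvz⟩ := hv p
  obtain ⟨z', p₁, p₂, p₃, hsplit, hp₂, hlen⟩ := exists_middle_piece hconn hp hz hvz hvy
  obtain ⟨q, hq, hqdet⟩ := hdet _ _ p₂ hp₂ hlen
  obtain ⟨hcard, hne, hqcard⟩ := card_toFinset_le_of_isDetour hε hqdet
  obtain ⟨p₀, hp₀⟩ := hconn.exists_length_eq v z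
  have hball : ∀ q' : Path G z z', (q'.length : ℝ) ≤ ℓ + (1 + ε) * ℓ →
      q'.edges.toFinset ⊆ R := by
    intro q' hq' e he
    rw [← Finset.mem_coe, hR]
    refine ⟨z', p₀.append q', ?_, by simpa using Or.inr (by simpa using he)⟩
    have h1 : (p₀.length : ℝ) ≤ ρ := by rw [hp₀]; exact_mod_cast hvz
    have h2 : ((p₀.append q').length : ℝ) ≤ r := by
      rw [Path.length_append]; push_cast; linarith
    exact_mod_cast h2
  have hℓ0 : (0 : ℝ) ≤ (1 + ε) * ℓ := by positivity
  have hp₂R : p₂.edges.toFinset ⊆ R := hball p₂ (by rw [hlen]; linarith)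
  have hqR : q.edges.toFinset ⊆ R := hball q (by
    have : q.length = q.edges.toFinset.card := (List.toFinset_card_of_nodup hq.edges_nodup).symm
    rw [this]; rwa [hlen] at hqcard)
  have hp₂p : p₂.edges.toFinset ⊆ p.edges.toFinset := fun e he => by
    simp only [List.mem_toFinset] at he ⊢
    rw [hsplit]; simp [he]
  -- The spliced path may intersect itself; loop erasure restores self-avoidance without raising the
  -- cost.
  obtain ⟨q', hq', hsub⟩ := (p₁.append (q.append p₃)).exists_isSelfAvoiding
  refine ⟨p₂.edges.toFinset \ q.edges.toFinset, q.edges.toFinset \ p₂.edges.toFinset,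
    Finset.sdiff_subset.trans hp₂p, Finset.sdiff_subset.trans hp₂R,
    Finset.sdiff_subset.trans hqR, ?_, hne, hcard, q'.edges.toFinset, ⟨?_, q', hq', rfl⟩,
    fun w => ?_⟩
  · exact disjoint_sdiff_sdiff
  · intro e he
    have h1 := hsub.subset (List.mem_toFinset.1 he)
    rw [Path.edges_append, Path.edges_append, List.mem_append, List.mem_append] at h1
    rcases h1 with h1 | h1 | h1
    · exact hAF (by rw [List.mem_toFinset, hsplit]; simp [h1])
    · exact hRF (hqR (List.mem_toFinset.2 h1))
    · exact hAF (by rw [List.mem_toFinset, hsplit]; simp [h1])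
  · have h1 : (q'.passageTime w : ℝ≥0∞) ≤
        p₁.passageTime w + (q.passageTime w + p₃.passageTime w) := by
      have h2 := Path.passageTime_le_of_sublist hsub w
      rw [Path.passageTime_of_edges_eq (p := p₁.append (q.append p₃)) (p₁ := p₁) (p₂ := q)
        (p₃ := p₃) (by rw [Path.edges_append, Path.edges_append])] at h2
      exact_mod_cast h2
    -- Both sides are the total weight of the union of the two edge sets.
    have h3 : (q.passageTime w : ℝ≥0∞) + ∑ e ∈ p₂.edges.toFinset \ q.edges.toFinset, (w e : ℝ≥0∞) =
        p₂.passageTime w + ∑ e ∈ q.edges.toFinset \ p₂.edges.toFinset, (w e : ℝ≥0∞) := by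
      rw [← hq.sum_toFinset, ← hp₂.sum_toFinset, ← Finset.sum_union Finset.disjoint_sdiff,
        ← Finset.sum_union Finset.disjoint_sdiff, Finset.union_sdiff_self_eq_union,
        Finset.union_sdiff_self_eq_union, Finset.union_comm]
    rw [hq'.sum_toFinset, hp.sum_toFinset, Path.passageTime_of_edges_eq hsplit w]
    push_cast
    calc _ ≤ (p₁.passageTime w : ℝ≥0∞) + (q.passageTime w + p₃.passageTime w) +
          ∑ e ∈ p₂.edges.toFinset \ q.edges.toFinset, (w e : ℝ≥0∞) := by gcongr
      _ = p₁.passageTime w + p₃.passageTime w + (q.passageTime w +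
          ∑ e ∈ p₂.edges.toFinset \ q.edges.toFinset, (w e : ℝ≥0∞)) := by ring
      _ = _ := by rw [h3]; ring

/-- In a quasi-tree with detours, there are linearly many disjoint regions of bounded size that
provide detours for all paths between two vertices. -/
theorem exists_disjoint_regions {W : Type*} {S : SimpleGraph W} (hconn : IsConnected G)
    (hdeg : HasBoundedDegree G) (hS : S.IsTree) (hqi : QuasiIsometricTo G S)
    (hdet : AdmitsDetours G) {ε : ℝ} (hε : 0 < ε) :
    ∃ (M : ℕ) (κ b : ℝ), 0 < κ ∧ ∀ x y : V(G), ∃ (n : ℕ) (R : ℕ → Finset E(G)),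
      κ * gdist G x y - b ≤ n ∧ (Finset.range n : Set ℕ).PairwiseDisjoint R ∧
      ∀ i < n, (R i).card ≤ M ∧ ∀ F, R i ⊆ F →
        HasDetoursWithin ε (pathSetsWithin G x y F) (R i) := by
  obtain ⟨ℓ, hℓ⟩ := hdet ε hε
  obtain ⟨ρ, hρ⟩ := exists_bottlenecks hS hqi
  set r : ℕ := ⌈ρ + (ℓ + (1 + ε) * ℓ)⌉₊ with hr
  obtain ⟨M, hM⟩ := hdeg.exists_edgeBall_eq r
  choose B hBM hB using hM
  -- The part `ρ + ℓ` leaves room for a piece of length `ℓ` before `y`; the part `2 * r + 1` makes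
  -- the balls disjoint.
  obtain ⟨κ, b, hκ, h⟩ := hρ (ρ + ℓ + 2 * r + 1)
  refine ⟨M, κ, b, hκ, fun x y => ?_⟩
  obtain ⟨n, v, hn, hv⟩ := h x y
  refine ⟨n, fun i => B (v i), hn, ?_, fun i hi => ⟨hBM _, fun F hF => ?_⟩⟩
  · intro i hi j hj hij
    refine Finset.disjoint_left.2 fun e he he' => ?_
    have hfar := (hv i (by simpa using hi)).2.2 j (by simpa using hj) hij
    rw [← Finset.mem_coe, hB] at he he'
    obtain ⟨a, c, hac⟩ := G.exists_isLink_of_mem_edgeSet e.2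
    have h1 := gdist_le_of_mem_edgeBall (a := ⟨a, hac.left_mem⟩) he hac.inc_left
    have h2 := gdist_le_of_mem_edgeBall (a := ⟨a, hac.left_mem⟩) he' hac.inc_left
    have h3 := hconn.gdist_triangle (v i) ⟨a, hac.left_mem⟩ (v j)
    rw [hconn.gdist_comm ⟨a, hac.left_mem⟩ (v j)] at h3
    omega
  · obtain ⟨h1, h2, -⟩ := hv i hi
    exact hasDetoursWithin_pathSetsWithin hconn hε.le hℓ (Nat.le_ceil _) h1 (by omega) (hB _) hF

/-! ### Expected passage times -/

lemma minCost_pathSetsWithin_antitone (x y : V(G)) (w : E(G) → ℝ≥0) :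
    Antitone fun F => minCost (pathSetsWithin G x y F) w := fun _ _ hF =>
  le_iInf₂ fun _ hA => minCost_le (𝒮 := pathSetsWithin G x y _) ⟨hA.1.trans hF, hA.2⟩ w

lemma coe_passageTime (hconn : IsConnected G) (w : E(G) → ℝ≥0) (x y : V(G)) :
    (passageTime G w x y : ℝ≥0∞) = ⨅ F, minCost (pathSetsWithin G x y F) w := by
  classical
  have := hconn x y
  rw [passageTime, ENNReal.coe_iInf]
  refine le_antisymm (le_iInf fun F => le_iInf₂ fun A hA => ?_) (le_iInf fun p => ?_)
  · obtain ⟨-, p, hp, rfl⟩ := hA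
    rw [hp.sum_toFinset]
    exact iInf_le _ p
  · obtain ⟨q, hq, hqp⟩ := p.exists_isSelfAvoiding
    refine (iInf_le _ q.edges.toFinset).trans
      ((minCost_le (𝒮 := pathSetsWithin G x y _) ⟨Finset.Subset.refl _, q, hq, rfl⟩ w).trans ?_)
    rw [hq.sum_toFinset]
    exact_mod_cast Path.passageTime_le_of_sublist hqp w

lemma exists_forall_pathSetsWithin_nonempty (hconn : IsConnected G) (x y : V(G)) :
    ∃ F₀, ∀ F, F₀ ⊆ F → (pathSetsWithin G x y F).Nonempty := by
  classical
  obtain ⟨p⟩ := hconn x y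
  obtain ⟨q, hq, -⟩ := p.exists_isSelfAvoiding
  exact ⟨q.edges.toFinset, fun F hF => ⟨_, hF, q, hq, rfl⟩⟩

section Expectation

variable (ν : Measure ℝ≥0) [IsProbabilityMeasure ν]

lemma lintegral_infinitePi_eq_lmarginal {E : Type*} [DecidableEq E] {f : (E → ℝ≥0) → ℝ≥0∞}
    (hf : Measurable f) {F : Finset E} (hF : ∀ w w', (∀ e ∈ F, w e = w' e) → f w = f w')
    (x : E → ℝ≥0) :
    ∫⁻ w, f w ∂(Measure.infinitePi fun _ => ν) = (∫⋯∫⁻_F, f ∂fun _ => ν) x := by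
  have h : ∀ w, f w = f (Function.updateFinset x F (F.restrict w)) := fun w =>
    hF _ _ fun e he => by simp [Function.updateFinset, he]
  rw [lintegral_congr h]
  rw [lintegral_restrict_infinitePi (fun _ => ν)
    (f := fun y => f (Function.updateFinset x F y)) (hf.comp measurable_updateFinset)]
  rfl

lemma minCost_congr {E : Type*} {𝒮 : Set (Finset E)} {F : Finset E} (h𝒮 : ∀ A ∈ 𝒮, A ⊆ F)
    {w w' : E → ℝ≥0} (h : ∀ e ∈ F, w e = w' e) : minCost 𝒮 w = minCost 𝒮 w' :=
  iInf_congr fun A => iInf_congr fun hA =>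
    Finset.sum_congr rfl fun e he => by rw [h e (h𝒮 A hA he)]

lemma lintegral_minCost_ne_top {E : Type*} {ν : Measure ℝ≥0} [IsProbabilityMeasure ν]
    (hν : HasFiniteMean ν) {𝒮 : Set (Finset E)} (h𝒮 : 𝒮.Nonempty) :
    ∫⁻ w, minCost 𝒮 w ∂(Measure.infinitePi fun _ => ν) ≠ ⊤ := by
  obtain ⟨A, hA⟩ := h𝒮
  refine ne_top_of_le_ne_top ?_ (lintegral_mono fun w => minCost_le hA w)
  rw [lintegral_finsetSum _ fun e _ => (measurable_pi_apply e).coe_nnreal_ennreal]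
  refine ENNReal.sum_ne_top.2 fun e _ => ?_
  have h1 := (measurePreserving_eval_infinitePi (fun _ : E => ν) e).lintegral_comp
    (f := fun t : ℝ≥0 => (t : ℝ≥0∞)) measurable_coe_nnreal_ennreal
  simp only [Function.eval] at h1
  rw [h1]
  have h2 := hν.lintegral_lt_top
  simpa using h2.ne

lemma lintegral_passageTime_ne_top {ν : Measure ℝ≥0} [IsProbabilityMeasure ν]
    (hconn : IsConnected G) (hν : HasFiniteMean ν) (x y : V(G)) :
    ∫⁻ w, (passageTime G w x y : ℝ≥0∞) ∂(Measure.infinitePi fun _ => ν) ≠ ⊤ := by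
  obtain ⟨F₀, hF₀⟩ := exists_forall_pathSetsWithin_nonempty hconn x y
  refine ne_top_of_le_ne_top (lintegral_minCost_ne_top hν (hF₀ F₀ subset_rfl))
    (lintegral_mono fun w => ?_)
  rw [coe_passageTime hconn]
  exact iInf_le _ F₀

variable [Countable E(G)]

lemma measurable_passageTime (hconn : IsConnected G) (x y : V(G)) :
    Measurable fun w => passageTime G w x y := by
  rw [← measurable_coe_nnreal_ennreal_iff]
  simp_rw [coe_passageTime hconn]
  exact Measurable.iInf fun F => measurable_minCost _

lemma expectedPassageTime_eq (hconn : IsConnected G) (x y : V(G)) :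
    expectedPassageTime G ν x y =
      (∫⁻ w, (passageTime G w x y : ℝ≥0∞) ∂(Measure.infinitePi fun _ => ν)).toReal := by
  have hm := measurable_passageTime hconn x y
  rw [expectedPassageTime, integral_eq_lintegral_of_nonneg_ae (ae_of_all _ fun w =>
    NNReal.coe_nonneg _) (Measurable.aestronglyMeasurable (by fun_prop))]
  simp

variable {ν}

/-- The passage time is the decreasing limit of the costs inside finite `F`. Adding `F₀` to each `F`
makes these costs integrable, so infimum and integral can be exchanged; adding `F₁` makes the bound
available. -/
lemma le_lintegral_passageTime (hconn : IsConnected G) (hν : HasFiniteMean ν) (x y : V(G))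
    {F₁ : Finset E(G)} {K : ℝ≥0∞}
    (h : ∀ F, F₁ ⊆ F →
      K ≤ ∫⁻ w, minCost (pathSetsWithin G x y F) w ∂(Measure.infinitePi fun _ => ν)) :
    K ≤ ∫⁻ w, (passageTime G w x y : ℝ≥0∞) ∂(Measure.infinitePi fun _ => ν) := by
  classical
  obtain ⟨F₀, hF₀⟩ := exists_forall_pathSetsWithin_nonempty hconn x y
  have heq : ∀ w, (passageTime G w x y : ℝ≥0∞) =
      ⨅ F, minCost (pathSetsWithin G x y (F ∪ (F₀ ∪ F₁))) w := fun w => by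
    rw [coe_passageTime hconn]
    refine le_antisymm (le_iInf fun F => iInf_le _ _) (iInf_mono fun F => ?_)
    exact minCost_pathSetsWithin_antitone x y w Finset.subset_union_left
  simp_rw [heq]
  rw [lintegral_iInf_directed_of_measurable (NeZero.ne _) (fun F => measurable_minCost _)
    (fun F => lintegral_minCost_ne_top hν (hF₀ _
      (Finset.subset_union_left.trans Finset.subset_union_right)))]
  · exact le_iInf fun F => h _ (Finset.subset_union_right.trans Finset.subset_union_right)
  · intro F F'
    exact ⟨F ∪ F', fun w => minCost_pathSetsWithin_antitone x y w
        (Finset.union_subset_union_left Finset.subset_union_left),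
      fun w => minCost_pathSetsWithin_antitone x y w
        (Finset.union_subset_union_left Finset.subset_union_right)⟩

/-- Gains in disjoint regions add up. -/
lemma lintegral_passageTime_add_le {ν' : Measure ℝ≥0} [IsProbabilityMeasure ν']
    (hconn : IsConnected G) (hν : HasFiniteMean ν) (hdom : MoreVariable ν' ν) (x y : V(G)) {n : ℕ}
    {R : ℕ → Finset E(G)} (hR : (Finset.range n : Set ℕ).PairwiseDisjoint R) {c : ℝ≥0∞}
    (hgain : letI := Classical.decEq E(G); ∀ i < n, ∀ F, R i ⊆ F →
      HasGain (minCost (pathSetsWithin G x y F)) ν' ν (R i) c) :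
    ∫⁻ w, (passageTime G w x y : ℝ≥0∞) ∂(Measure.infinitePi fun _ => ν') + n * c ≤
      ∫⁻ w, (passageTime G w x y : ℝ≥0∞) ∂(Measure.infinitePi fun _ => ν) := by
  let := Classical.decEq E(G)
  refine le_lintegral_passageTime hconn hν x y (F₁ := (Finset.range n).biUnion R) fun F hF => ?_
  have hm := measurable_minCost (pathSetsWithin G x y F)
  have hdep : ∀ w w' : E(G) → ℝ≥0, (∀ e ∈ F, w e = w' e) →
      minCost (pathSetsWithin G x y F) w = minCost (pathSetsWithin G x y F) w' := fun w w' =>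
    minCost_congr fun A hA => hA.1
  have h1 := HasGain.biUnion (ν := ν) (ν' := ν') hm (Finset.range n) R hR (c := c) fun i hi =>
    hgain i (Finset.mem_range.1 hi) F ((Finset.subset_biUnion_of_mem R hi).trans hF)
  -- The edges of `F` outside the regions are switched too, at no loss.
  have h2 : HasGain (minCost (pathSetsWithin G x y F)) ν' ν (F \ (Finset.range n).biUnion R) 0 :=
    HasGain.of_minDominated (MinDominated.of_truncMean_le fun s _ => hdom.truncMean_le s) _ _
  have h3 := h1.union hm Finset.disjoint_sdiff h2
  rw [Finset.union_sdiff_of_subset hF, add_zero, Finset.card_range] at h3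
  rw [lintegral_infinitePi_eq_lmarginal ν hm hdep 0]
  refine le_trans ?_ (h3 0)
  rw [← lintegral_infinitePi_eq_lmarginal ν' hm hdep 0]
  gcongr with w
  rw [coe_passageTime hconn]
  exact iInf_le _ F

end Expectation

/-! ### Detours imply strict inequality -/

theorem asympStrictlyLess_of_admitsDetours {W : Type*} {S : SimpleGraph W} (hconn : IsConnected G)
    (hdeg : HasBoundedDegree G) (hS : S.IsTree) (hqi : QuasiIsometricTo G S)
    (hdet : AdmitsDetours G) (ν ν' : Measure ℝ≥0) [IsProbabilityMeasure ν]
    [IsProbabilityMeasure ν'] (hν : HasFiniteMean ν) (hν' : HasFiniteMean ν')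
    (h : StrictlyMoreVariable ν' ν) : AsympStrictlyLess G ν' ν := by
  have := countable_edgeSet hconn hdeg
  let := Classical.decEq E(G)
  obtain ⟨ε, hε, hgain⟩ := h.exists_hasGain (E := E(G)) hν
  obtain ⟨M, κ, b, hκ, hreg⟩ := exists_disjoint_regions hconn hdeg hS hqi hdet hε
  obtain ⟨c, hc, hcM⟩ := hgain M
  have hc' : (0 : ℝ) < c := hc
  have key : ∀ x y : V(G), c * (κ * gdist G x y - b) ≤
      expectedPassageTime G ν x y - expectedPassageTime G ν' x y := by
    intro x y
    obtain ⟨n, R, hn, hdisj, hR⟩ := hreg x y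
    have h1 := lintegral_passageTime_add_le hconn hν h.1 x y hdisj (c := c) fun i hi F hF =>
      hcM _ _ (hR i hi).1 ((hR i hi).2 F hF)
    have h2 := ENNReal.toReal_mono (lintegral_passageTime_ne_top hconn hν x y) h1
    rw [ENNReal.toReal_add (lintegral_passageTime_ne_top hconn hν' x y)
      (ENNReal.mul_ne_top (by simp) (by simp)), ← expectedPassageTime_eq ν' hconn,
      ← expectedPassageTime_eq ν hconn] at h2
    simp only [ENNReal.toReal_mul, ENNReal.toReal_natCast, ENNReal.coe_toReal] at h2
    have h3 := mul_le_mul_of_nonneg_left hn hc'.le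
    linarith
  have hpos : (0 : EReal) < ((c * κ / 2 : ℝ) : EReal) := by
    exact_mod_cast (by positivity : 0 < c * κ / 2)
  refine hpos.trans_le (le_liminf_of_le (by isBoundedDefault) ?_)
  -- Beyond distance `2 * b / κ` the additive error costs at most half of the linear gain.
  filter_upwards [tendsto_comap.eventually (eventually_ge_atTop (⌈2 * b / κ⌉₊ + 1))] with z hz
  have hd0 : (0 : ℝ) < gdist G z.1 z.2 := by
    exact_mod_cast lt_of_lt_of_le (Nat.succ_pos _) hz
  have hd : 2 * b ≤ κ * gdist G z.1 z.2 := by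
    have h1 : 2 * b / κ ≤ gdist G z.1 z.2 :=
      (Nat.le_ceil _).trans (by exact_mod_cast (Nat.le_succ _).trans hz)
    rw [div_le_iff₀ hκ] at h1
    linarith
  rw [EReal.coe_le_coe_iff, le_div_iff₀ hd0]
  refine le_trans ?_ (key z.1 z.2)
  nlinarith

/-! ### The geodesic percolation threshold is positive -/

lemma Path.IsGeodesic.edges_nodup {x y : V(G)} {p : Path G x y} (hp : p.IsGeodesic) :
    p.edges.Nodup := by
  obtain ⟨q, hq, hqp⟩ := p.exists_isSelfAvoiding
  rw [← hqp.eq_of_length_le (hp q)]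
  exact hq.edges_nodup

lemma setBernoulli_superset {E : Type*} (p : unitInterval) (l : Finset E) :
    ProbabilityTheory.setBernoulli Set.univ p {A : Set E | ∀ e ∈ l, e ∈ A} =
      (unitInterval.toNNReal p : ℝ≥0∞) ^ l.card := by
  rw [ProbabilityTheory.setBernoulli_apply']
  have h : (fun p : E → Prop => {i | p i}) ⁻¹' {A : Set E | ∀ e ∈ l, e ∈ A} =
      Set.pi l fun _ => {True} := by
    ext t; simp [Set.mem_pi]
  rw [h, Measure.infinitePi_pi _ fun _ _ => MeasurableSet.of_discrete]
  simp

/-- Union bound over the first `R + 1` edges of the geodesic, which are distinct because a geodesic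
has no loops to erase. -/
lemma setBernoulli_escapesGeodesically_le {D : ℕ}
    (hD : ∀ x : V(G), (G.incidenceSet x).encard ≤ D) (p : unitInterval) (o : V(G)) (R : ℕ) :
    ProbabilityTheory.setBernoulli Set.univ p (escapesGeodesically G o R) ≤
      (D * unitInterval.toNNReal p : ℝ≥0∞) ^ (R + 1) := by
  classical
  obtain ⟨L, hL, hLp⟩ := exists_finset_edges D hD (R + 1) o
  set L' := L.filter fun l => l.Nodup ∧ l.length = R + 1 with hL'
  have hsub : escapesGeodesically G o R ⊆ ⋃ l ∈ L', {A | ∀ e ∈ l.toFinset, e ∈ A} := by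
    rintro A ⟨y, q, hq, hqA, hgeo⟩
    obtain ⟨z, p₁, p₂, h1, h2, -⟩ :=
      q.exists_split_of_le_length (n := R + 1) ((Nat.succ_le_of_lt hq).trans (gdist_le q))
    have hnd := hgeo.edges_nodup
    rw [h1] at hnd
    refine Set.mem_iUnion₂.2 ⟨p₁.edges, Finset.mem_filter.2
      ⟨hLp z p₁ h2, hnd.of_append_left, h2⟩, fun e he => hqA ?_⟩
    simp only [Path.edgeSet, Set.mem_ofPred_eq]
    rw [h1]; simp [List.mem_toFinset.1 he]
  refine (measure_mono hsub).trans ((measure_biUnion_finset_le _ _).trans ?_)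
  have h3 : ∀ l ∈ L', ProbabilityTheory.setBernoulli Set.univ p {A | ∀ e ∈ l.toFinset, e ∈ A} =
      (unitInterval.toNNReal p : ℝ≥0∞) ^ (R + 1) := fun l hl => by
    obtain ⟨-, h4, h5⟩ := Finset.mem_filter.1 hl
    rw [setBernoulli_superset, List.toFinset_card_of_nodup h4, h5]
  rw [Finset.sum_congr rfl h3, Finset.sum_const, nsmul_eq_mul, mul_pow]
  gcongr
  exact_mod_cast (Finset.card_filter_le _ _).trans hL

lemma expGeodesicThreshold_pos (hdeg : HasBoundedDegree G) :
    (0 : ℝ) < (expGeodesicThreshold G : ℝ) := by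
  obtain ⟨D, hD⟩ := hdeg
  -- For this `p` one has `D * p ≤ 1 / 2`, so the escape probability decays at least like `2⁻ᴿ`,
  -- uniformly in `o`.
  have hp0 : (0 : ℝ) < 1 / (2 * ((D : ℝ) + 1)) := by positivity
  have hp1 : 1 / (2 * ((D : ℝ) + 1)) ≤ 1 := by
    rw [div_le_one (by positivity)]
    linarith [(Nat.cast_nonneg D : (0 : ℝ) ≤ D)]
  set p : unitInterval := ⟨1 / (2 * ((D : ℝ) + 1)), hp0.le, hp1⟩ with hp
  have hDp : (D * unitInterval.toNNReal p : ℝ≥0∞) ≤ ENNReal.ofReal (1 / 2) := by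
    have h1 : (unitInterval.toNNReal p : ℝ≥0∞) = ENNReal.ofReal (p : ℝ) := by
      rw [← ENNReal.ofReal_coe_nnreal]; rfl
    rw [h1, ← ENNReal.ofReal_natCast, ← ENNReal.ofReal_mul (Nat.cast_nonneg D)]
    refine ENNReal.ofReal_le_ofReal ?_
    simp only [hp]
    rw [mul_one_div, div_le_div_iff₀ (by positivity) (by norm_num)]
    linarith
  have hle : p ≤ expGeodesicThreshold G := by
    refine le_sSup ?_
    have hlog : Real.log (1 / 2) < 0 := Real.log_neg (by norm_num) (by norm_num)
    have hlt : ((Real.log (1 / 2) : ℝ) : EReal) < 0 := by exact_mod_cast hlog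
    refine lt_of_le_of_lt (limsup_le_of_le (by isBoundedDefault) ?_) hlt
    filter_upwards [eventually_ge_atTop 1] with R hR
    refine iSup_le fun o => ?_
    have hR' : (0 : ℝ) < R := by exact_mod_cast hR
    have h1 : ENNReal.log (ProbabilityTheory.setBernoulli Set.univ p
        (escapesGeodesically G o R)) ≤ (((R : ℝ) + 1) * Real.log (1 / 2) : ℝ) := by
      refine (ENNReal.log_le_log ((setBernoulli_escapesGeodesically_le hD p o R).trans
        (pow_le_pow_left' hDp (R + 1)))).trans ?_
      rw [ENNReal.log_pow, ENNReal.log_ofReal_of_pos (by norm_num)]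
      push_cast
      exact le_rfl
    refine (mul_le_mul_of_nonneg_left h1 (by exact_mod_cast (by positivity))).trans ?_
    rw [← EReal.coe_mul, EReal.coe_le_coe_iff, ← mul_assoc]
    have h2 : 1 ≤ 1 / (R : ℝ) * (R + 1) := by
      rw [one_div_mul_eq_div, le_div_iff₀ hR']; linarith
    nlinarith
  exact hp0.trans_le (show (p : ℝ) ≤ expGeodesicThreshold G from hle)

/-! ### Paths without detours are geodesics for nearly constant weights -/

/-- Common edges cancel. If the edge sets differ, then `|q \ p| > (1 + ε) |p \ q|`, which outweighs
the largest possible ratio of weights. -/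
lemma Path.IsSelfAvoiding.passageTime_le_of_not_isDetour {ε : ℝ} {x y : V(G)} {p q : Path G x y}
    (hp : p.IsSelfAvoiding) (hq : q.IsSelfAvoiding) (h : ¬ q.IsDetour ε p) {w : E(G) → ℝ≥0}
    (hw : ∀ e, 1 ≤ (w e : ℝ) ∧ (w e : ℝ) ≤ 1 + ε) : p.passageTime w ≤ q.passageTime w := by
  classical
  have hsum : ∀ {p : Path G x y}, p.IsSelfAvoiding →
      (p.passageTime w : ℝ) = ∑ e ∈ p.edges.toFinset, (w e : ℝ) := fun {p} hp => by
    rw [← NNReal.coe_sum, List.sum_toFinset w hp.edges_nodup]; rfl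
  rw [← NNReal.coe_le_coe, hsum hp, hsum hq]
  rw [Path.IsDetour, Path.edgeSet_eq_coe_toFinset, Path.edgeSet_eq_coe_toFinset,
    ← Finset.coe_sdiff, ← Finset.coe_sdiff, Set.ncard_coe_finset, Set.ncard_coe_finset,
    not_and, not_le] at h
  by_cases heq : q.edges.toFinset = p.edges.toFinset
  · rw [heq]
  · have h1 := h (fun h' => heq (Finset.coe_injective h'))
    rw [← Finset.sum_sdiff_le_sum_sdiff]
    calc ∑ e ∈ p.edges.toFinset \ q.edges.toFinset, (w e : ℝ)
        ≤ ∑ e ∈ p.edges.toFinset \ q.edges.toFinset, (1 + ε) :=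
          Finset.sum_le_sum fun e _ => (hw e).2
      _ = (1 + ε) * (p.edges.toFinset \ q.edges.toFinset).card := by
          rw [Finset.sum_const, nsmul_eq_mul, mul_comm]
      _ ≤ ∑ e ∈ q.edges.toFinset \ p.edges.toFinset, (1 : ℝ) := by
          rw [Finset.sum_const, nsmul_eq_mul, mul_one]; exact h1.le
      _ ≤ _ := Finset.sum_le_sum fun e _ => (hw e).1

lemma Path.IsSelfAvoiding.passageTime_le {ε : ℝ} {x y : V(G)} {p : Path G x y}
    (hp : p.IsSelfAvoiding) (h : ∀ q : Path G x y, q.IsSelfAvoiding → ¬ q.IsDetour ε p)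
    {w : E(G) → ℝ≥0} (hw : ∀ e, 1 ≤ (w e : ℝ) ∧ (w e : ℝ) ≤ 1 + ε) (q : Path G x y) :
    p.passageTime w ≤ q.passageTime w := by
  obtain ⟨q', hq', hsub⟩ := q.exists_isSelfAvoiding
  exact (hp.passageTime_le_of_not_isDetour hq' (h q' hq') hw).trans
    (Path.passageTime_le_of_sublist hsub w)

lemma Path.passageTime_one {x y : V(G)} (p : Path G x y) :
    p.passageTime (fun _ => 1) = p.length := by
  simp [Path.passageTime, Path.length]

lemma Path.IsSelfAvoiding.gdist_eq_length (hconn : IsConnected G) {ε : ℝ} (hε : 0 ≤ ε)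
    {x y : V(G)} {p : Path G x y} (hp : p.IsSelfAvoiding)
    (h : ∀ q : Path G x y, q.IsSelfAvoiding → ¬ q.IsDetour ε p) : gdist G x y = p.length := by
  refine le_antisymm (gdist_le p) ?_
  obtain ⟨q, hq⟩ := hconn.exists_length_eq x y
  have h1 := hp.passageTime_le h (w := fun _ => 1) (fun _ => by simpa using hε) q
  rw [Path.passageTime_one, Path.passageTime_one] at h1
  rw [← hq]
  exact_mod_cast h1

/-- Almost surely `p` is optimal, so only linearity of expectation along the fixed path remains. -/
lemma Path.IsSelfAvoiding.expectedPassageTime_eq [Countable E(G)] {ε : ℝ} {x y : V(G)}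
    {p : Path G x y} (hp : p.IsSelfAvoiding)
    (h : ∀ q : Path G x y, q.IsSelfAvoiding → ¬ q.IsDetour ε p) (ν : Measure ℝ≥0)
    [IsProbabilityMeasure ν] (hν : HasFiniteMean ν)
    (hsupp : ∀ᵐ t : ℝ≥0 ∂ν, 1 ≤ (t : ℝ) ∧ (t : ℝ) ≤ 1 + ε) :
    expectedPassageTime G ν x y = p.length * ∫ t : ℝ≥0, (t : ℝ) ∂ν := by
  classical
  have hev : ∀ e : E(G), MeasurePreserving (fun w : E(G) → ℝ≥0 => w e)
      (Measure.infinitePi fun _ => ν) ν := fun e => measurePreserving_eval_infinitePi (fun _ => ν) e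
  have hae : ∀ᵐ w ∂(Measure.infinitePi fun _ : E(G) => ν),
      ∀ e, 1 ≤ (w e : ℝ) ∧ (w e : ℝ) ≤ 1 + ε :=
    ae_all_iff.2 fun e => (hev e).quasiMeasurePreserving.ae hsupp
  have h1 : expectedPassageTime G ν x y =
      ∫ w : E(G) → ℝ≥0, ∑ e ∈ p.edges.toFinset, (w e : ℝ) ∂(Measure.infinitePi fun _ => ν) := by
    refine integral_congr_ae ?_
    filter_upwards [hae] with w hw
    have h2 : FPP.passageTime G w x y = p.passageTime w :=
      le_antisymm (ciInf_le (OrderBot.bddBelow _) p)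
        (have : Nonempty (Path G x y) := ⟨p⟩; le_ciInf (hp.passageTime_le h hw))
    rw [h2, ← NNReal.coe_sum, List.sum_toFinset w hp.edges_nodup]; rfl
  have h3 : ∀ e : E(G), ∫ w : E(G) → ℝ≥0, (w e : ℝ) ∂(Measure.infinitePi fun _ => ν) =
      ∫ t : ℝ≥0, (t : ℝ) ∂ν := fun e => by
    conv_rhs => rw [← (hev e).map_eq]
    rw [integral_map (measurable_pi_apply e).aemeasurable
      (Measurable.aestronglyMeasurable (by fun_prop))]
  rw [h1, integral_finsetSum p.edges.toFinset
    (f := fun (e : E(G)) (w : E(G) → ℝ≥0) => (w e : ℝ))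
    fun e _ => (hev e).integrable_comp_of_integrable hν]
  simp_rw [h3]
  rw [Finset.sum_const, nsmul_eq_mul, List.toFinset_card_of_nodup hp.edges_nodup]; rfl

/-! ### Two weight distributions with the same mean -/

section Atoms

variable (P h : ℝ≥0)

/-- Mass `P` at `1` and the remaining mass at `1 + 2h`. -/
noncomputable def twoAtoms : Measure ℝ≥0 :=
  P • Measure.dirac 1 + (1 - P) • Measure.dirac (1 + 2 * h)

/-- Mass `P` at `1` and the remaining mass distributed evenly on `1 + h` and `1 + 3h`. -/
noncomputable def threeAtoms : Measure ℝ≥0 :=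
  P • Measure.dirac 1 +
    ((1 - P) / 2) • (Measure.dirac (1 + h) + Measure.dirac (1 + 3 * h))

variable {P h}

lemma isProbabilityMeasure_twoAtoms (hP : P ≤ 1) : IsProbabilityMeasure (twoAtoms P h) := by
  refine ⟨?_⟩
  simp only [twoAtoms, Measure.add_apply, Measure.smul_apply, measure_univ, ENNReal.smul_def,
    smul_eq_mul, mul_one]
  exact_mod_cast add_tsub_cancel_of_le hP

lemma isProbabilityMeasure_threeAtoms (hP : P ≤ 1) : IsProbabilityMeasure (threeAtoms P h) := by
  refine ⟨?_⟩
  simp only [threeAtoms, Measure.add_apply, Measure.smul_apply, measure_univ, ENNReal.smul_def,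
    smul_eq_mul, mul_one]
  norm_cast
  rw [Nat.cast_add, Nat.cast_one, one_add_one_eq_two, div_mul_cancel₀ _ two_ne_zero,
    add_tsub_cancel_of_le hP]

lemma integrable_dirac' (f : ℝ≥0 → ℝ) (a : ℝ≥0) : Integrable f (Measure.dirac a) :=
  integrable_dirac (by simp)

lemma integrable_twoAtoms (f : ℝ≥0 → ℝ) : Integrable f (twoAtoms P h) :=
  ((integrable_dirac' f _).smul_measure_nnreal).add_measure
    ((integrable_dirac' f _).smul_measure_nnreal)

lemma integrable_threeAtoms (f : ℝ≥0 → ℝ) : Integrable f (threeAtoms P h) :=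
  ((integrable_dirac' f _).smul_measure_nnreal).add_measure
    (((integrable_dirac' f _).add_measure (integrable_dirac' f _)).smul_measure_nnreal)

lemma integral_twoAtoms (hP : P ≤ 1) (f : ℝ≥0 → ℝ) :
    ∫ t, f t ∂twoAtoms P h = P * f 1 + (1 - P) * f (1 + 2 * h) := by
  rw [twoAtoms, integral_add_measure (integrable_dirac' f _).smul_measure_nnreal
    (integrable_dirac' f _).smul_measure_nnreal, integral_smul_nnreal_measure,
    integral_smul_nnreal_measure, integral_dirac, integral_dirac]
  simp [NNReal.smul_def, NNReal.coe_sub hP]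

lemma integral_threeAtoms (hP : P ≤ 1) (f : ℝ≥0 → ℝ) :
    ∫ t, f t ∂threeAtoms P h =
      P * f 1 + (1 - P) / 2 * (f (1 + h) + f (1 + 3 * h)) := by
  rw [threeAtoms, integral_add_measure (integrable_dirac' f _).smul_measure_nnreal
    ((integrable_dirac' f _).add_measure (integrable_dirac' f _)).smul_measure_nnreal,
    integral_smul_nnreal_measure, integral_smul_nnreal_measure,
    integral_add_measure (integrable_dirac' f _) (integrable_dirac' f _), integral_dirac,
    integral_dirac, integral_dirac]
  simp [NNReal.smul_def, NNReal.coe_sub hP, mul_add]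

lemma ae_twoAtoms {p : ℝ≥0 → Prop} (h1 : p 1) (h2 : p (1 + 2 * h)) : ∀ᵐ t ∂twoAtoms P h, p t := by
  rw [twoAtoms, ae_add_measure_iff]
  exact ⟨Measure.ae_smul_measure (by simpa [ae_dirac_eq] using h1) _,
    Measure.ae_smul_measure (by simpa [ae_dirac_eq] using h2) _⟩

lemma ae_threeAtoms {p : ℝ≥0 → Prop} (h1 : p 1) (h2 : p (1 + h)) (h3 : p (1 + 3 * h)) :
    ∀ᵐ t ∂threeAtoms P h, p t := by
  rw [threeAtoms, ae_add_measure_iff]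
  refine ⟨Measure.ae_smul_measure (by simpa [ae_dirac_eq] using h1) _,
    Measure.ae_smul_measure ?_ _⟩
  rw [ae_add_measure_iff]
  exact ⟨by simpa [ae_dirac_eq] using h2, by simpa [ae_dirac_eq] using h3⟩

lemma strictlyMoreVariable_atoms (hP : P < 1) (hh : 0 < h) :
    StrictlyMoreVariable (threeAtoms P h) (twoAtoms P h) := by
  have hP' : (0 : ℝ) < 1 - P := sub_pos.2 hP
  refine ⟨fun f hf _ _ _ => ?_, fun heq => ?_⟩
  · rw [integral_threeAtoms hP.le, integral_twoAtoms hP.le]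
    have := hf.2 (Set.mem_univ (1 + h : ℝ)) (Set.mem_univ (1 + 3 * h : ℝ))
      (by norm_num : (0 : ℝ) ≤ 1 / 2) (by norm_num : (0 : ℝ) ≤ 1 / 2) (by norm_num)
    simp only [smul_eq_mul] at this
    rw [show 1 / 2 * (1 + (h : ℝ)) + 1 / 2 * (1 + 3 * h) = 1 + 2 * h by ring] at this
    push_cast
    nlinarith
  · have h0 : (0 : ℝ) < h := hh
    -- The mean distance to `1 + 2h` tells the measures apart: splitting that atom adds `(1 - P) h`.
    have h1 : ∫ t : ℝ≥0, |(t : ℝ) - (1 + 2 * h)| ∂threeAtoms P h =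
        ∫ t : ℝ≥0, |(t : ℝ) - (1 + 2 * h)| ∂twoAtoms P h := by rw [heq]
    rw [integral_threeAtoms hP.le, integral_twoAtoms hP.le] at h1
    push_cast at h1
    rw [show 1 + (h : ℝ) - (1 + 2 * h) = -h by ring, show 1 + 3 * (h : ℝ) - (1 + 2 * h) = h by ring,
      abs_neg, abs_of_pos h0, sub_self, abs_zero] at h1
    have := mul_pos hP' h0
    nlinarith

lemma sInf_support_twoAtoms (hP : 0 < P) : sInf (twoAtoms P h).support = 1 := by
  have hclosed : (twoAtoms P h).support ⊆ Set.Ici 1 :=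
    Measure.support_subset_of_isClosed isClosed_Ici (ae_twoAtoms (by simp) (by simp))
  have hmem : 1 ∈ (twoAtoms P h).support := by
    rw [Measure.mem_support_iff_forall]
    intro U hU
    have : Measure.dirac (1 : ℝ≥0) U = 1 := Measure.dirac_apply_of_mem (mem_of_mem_nhds hU)
    simp only [twoAtoms, Measure.add_apply, Measure.smul_apply, this, ENNReal.smul_def,
      smul_eq_mul, mul_one]
    exact lt_of_lt_of_le (by exact_mod_cast hP) le_self_add
  exact le_antisymm (csInf_le (OrderBot.bddBelow _) hmem) (le_csInf ⟨1, hmem⟩ hclosed)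

lemma twoAtoms_real_singleton (hh : 0 < h) : (twoAtoms P h).real {1} = P := by
  have h1 : (1 : ℝ≥0) + 2 * h ≠ 1 := by simpa using hh.ne'
  simp [twoAtoms, Measure.real, h1]

end Atoms

/-! ### The vdBK property implies detours -/

theorem admitsDetours_of_hasVdBK (hconn : IsConnected G) (hdeg : HasBoundedDegree G)
    (hG : HasVdBK G) : AdmitsDetours G := by
  have := countable_edgeSet hconn hdeg
  by_contra hcon
  simp only [AdmitsDetours, not_forall, not_exists, not_and, exists_prop] at hcon
  obtain ⟨ε, hε, hcon⟩ := hcon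
  set τ : ℝ := (expGeodesicThreshold G : ℝ) with hτ
  have hτ0 : 0 < τ := expGeodesicThreshold_pos hdeg
  have hτ1 : τ ≤ 1 := (expGeodesicThreshold G).2.2
  -- The atom at the infimum `1` gets half the threshold, which gives subcriticality; `h = ε / 4`
  -- keeps all atoms, up to `1 + 3h`, inside `[1, 1 + ε]`.
  obtain ⟨P, hP⟩ : ∃ P : ℝ≥0, (P : ℝ) = τ / 2 := ⟨⟨τ / 2, by positivity⟩, rfl⟩
  obtain ⟨h, hh⟩ : ∃ h : ℝ≥0, (h : ℝ) = ε / 4 := ⟨⟨ε / 4, by positivity⟩, rfl⟩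
  have hP0 : 0 < P := by rw [← NNReal.coe_pos, hP]; positivity
  have hP1 : P < 1 := by rw [← NNReal.coe_lt_coe, hP, NNReal.coe_one]; linarith
  have hh0 : 0 < h := by rw [← NNReal.coe_pos, hh]; positivity
  have := isProbabilityMeasure_twoAtoms (h := h) hP1.le
  have := isProbabilityMeasure_threeAtoms (h := h) hP1.le
  have hsub : IsExpSubcritical G (twoAtoms P h) := by
    refine Or.inr ?_
    rw [sInf_support_twoAtoms hP0, twoAtoms_real_singleton hh0, hP]
    exact ⟨one_pos, by linarith⟩
  have hfin := integrable_twoAtoms (P := P) (h := h) fun t => (t : ℝ)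
  have hfin' := integrable_threeAtoms (P := P) (h := h) fun t => (t : ℝ)
  have hlt : AsympStrictlyLess G (threeAtoms P h) (twoAtoms P h) :=
    hG _ _ hfin hfin' hsub (strictlyMoreVariable_atoms hP1 hh0)
  refine absurd hlt (not_lt.2 (liminf_le_of_frequently_le ?_ (by isBoundedDefault)))
  rw [frequently_comap]
  -- For every length `C` a path without detours gives a pair at distance exactly `C` with equal
  -- expectations, so the quotient vanishes at arbitrarily large distances.
  refine Eventually.frequently (Eventually.of_forall fun C => ?_)
  obtain ⟨x, y, p, hp, hlen, hq⟩ := hcon C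
  refine ⟨(x, y), by rw [hp.gdist_eq_length hconn hε.le hq, hlen], ?_⟩
  have e1 := hp.expectedPassageTime_eq hq (twoAtoms P h) hfin
    (ae_twoAtoms (by constructor <;> push_cast <;> linarith)
      (by constructor <;> push_cast <;> linarith))
  have e2 := hp.expectedPassageTime_eq hq (threeAtoms P h) hfin'
    (ae_threeAtoms (by constructor <;> push_cast <;> linarith)
      (by constructor <;> push_cast <;> linarith) (by constructor <;> push_cast <;> linarith))
  rw [integral_twoAtoms hP1.le] at e1
  rw [integral_threeAtoms hP1.le] at e2
  have e3 : expectedPassageTime G (twoAtoms P h) x y =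
      expectedPassageTime G (threeAtoms P h) x y := by
    rw [e1, e2]; push_cast; ring
  simp [e3]

end Graphs

end FPP

theorem theorem3 {α β W : Type*} (G : Graph α β) [G.Loopless] (hinf : V(G).Infinite)
    (hconn : FPP.IsConnected G) (hdeg : FPP.HasBoundedDegree G)
    (S : SimpleGraph W) (hS : S.IsTree) (hqi : FPP.QuasiIsometricTo G S) :
    (FPP.HasVdBK G ↔ FPP.AdmitsDetours G) ∧
      (FPP.AdmitsDetours G →
        ∀ (ν ν' : Measure ℝ≥0) [IsProbabilityMeasure ν] [IsProbabilityMeasure ν'],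
          FPP.HasFiniteMean ν → FPP.HasFiniteMean ν' → FPP.StrictlyMoreVariable ν' ν →
            FPP.AsympStrictlyLess G ν' ν) := by
  have key := fun hdet : FPP.AdmitsDetours G => FPP.asympStrictlyLess_of_admitsDetours hconn hdeg hS
    hqi hdet
  exact ⟨⟨FPP.admitsDetours_of_hasVdBK hconn hdeg,
    fun hdet ν ν' _ _ hν hν' _ h => key hdet ν ν' hν hν' h⟩, key⟩
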